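/- Let $k_1,k_2\ge 1$ be integers, let $\beta_{-2k_1},\dots,\beta_{2k_2-2},\beta_{2k_2}$ be real numbers with $\beta_{-2k_1}>0$ (the number $\beta_{2k_2-1}$ is missing), and for $x\in\mathbb R$ let $\beta(x)=(\beta_{-2k_1},\dots,\beta_{2k_2-2},x,\beta_{2k_2})$. **Notation.** A representing measure for $\beta(x)$ supported on $\mathbb R\setminus\{0\}$ is a positive Borel measure $\mu$ on $\mathbb R$ with $\mu(\{0\})=0$ such that for all $-2k_1\le i\le 2k_2$ the function $\xi\mapsto\xi^i$ is $\mu$-integrable and $\int \xi^i\,d\mu(\xi)$ is the entry of $\beta(x)$ of index $i$. It is $m$-atomic if it is a combination with positive coefficients of point masses at $m$ distinct points. Write $M(n_1,n_2)=(\beta_{i+j})_{i,j=n_1}^{n_2}$ (the empty matrix if $n_2<n_1$), $$v=(\beta_{-k_1+k_2+1},\dots,\beta_{2k_2-2}),\quad u=(\beta_{-k_1+k_2},\dots,\beta_{2k_2-2}),\quad w=(\beta_{-k_1+k_2-1},\dots,\beta_{2k_2-3}),$$ $$\widetilde A=\begin{pmatrix}M(-k_1+1,k_2-2)&v^T\\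 v&\beta_{2k_2}\end{pmatrix},\qquad \widehat A=\begin{pmatrix}M(-k_1,k_2-2)&u^T\\ u&\beta_{2k_2}\end{pmatrix},\qquad C=(\beta_{i+j+1})_{i,j=-k_1}^{k_2-2}.$$ $A^\dagger$ is the Moore–Penrose inverse, and $\begin{pmatrix}A&B\\ B^T&D\end{pmatrix}\big/A=D-B^TA^\dagger B$ is the generalized Schur complement. $A_{\beta(x)}$ is the matrix $(\beta_{i+j})_{i,j=-k_1}^{k_2}$ in which the entries with $i+j=2k_2-1$ are unspecified; it is partially positive semidefinite if all its fully specified principal submatrices are positive semidefinite. For a real sequence $a=(a_0,\dots,a_{2k})$ let $\mathbf a_j=(a_j,\dots,a_{j+k})^T$ for $0\le j\le k$ be the columns of $A_a=(a_{i+j})_{i,j=0}^k$. The rank of $a$ is $k+1$ if $A_a$ is nonsingular, and otherwise the least $i$ with $\mathbf a_i\in\operatorname{span}\{\mathbf a_0,\dots,\mathbf a_{i-1}\}$; $a$ is singular if its rank is less than $k+1$. With $r$ the rank of $a$, $a$ is *positively recursively generated* if $H=(a_{i+j})_{i,j=0}^{r-1}\succ0$ and, when $r<k+1$, with $(\varphi_0,\dots,\varphi_{r-1})^T=H^{-1}(a_r,\dots,a_{2r-1})^T$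 one has $a_j=\sum_{i=0}^{r-1}\varphi_i a_{j-r+i}$ for $r\le j\le 2k$. With $r'$ the rank of the reversed sequence $(a_{2k},\dots,a_0)$, $a$ is *negatively recursively generated* if $H'=(a_{i+j})_{i,j=k-r'+1}^{k}\succ0$ and, when $r'<k+1$, with $(\psi_0,\dots,\psi_{r'-1})^T=H'^{-1}(a_{2k-2r'+1},\dots,a_{2k-r'})^T$ one has $a_{2k-r'-j}=\sum_{i=0}^{r'-1}\psi_i a_{2k-r'-j+1+i}$ for $0\le j\le 2k-r'$. It is *recursively generated* if it is both. The generating polynomial of a singular $a$ is $X^r-\sum_{i=0}^{r-1}\varphi_iX^i$. These notions are applied to $\beta(x)$ with $k=k_1+k_2$ and $a_i$ the entry of $\beta(x)$ of index $i-2k_1$. **Statement.** The following are equivalent: 1. There is $x_0\in\mathbb R$ such that $\beta(x_0)$ has a representing measure supported on $\mathbb R\setminus\{0\}$. 2. There is $x_0\in\mathbb R$ such that $\beta(x_0)$ is recursively generated. 3. There is $x_0\in\mathbb R$ such that $\beta(x_0)$ is singular and recursively generated. 4. There is $x_0\in\mathbb R$ such that $\beta(x_0)$ has a $(\operatorname{rank}M(-k_1,k_2-1))$-atomic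 representing measure supported on $\mathbb R\setminus\{0\}$. 5. $A_{\beta(x)}$ is partially positive semidefinite and one of the following holds: (a) $M(-k_1,k_2-1)\succ0$ and $\widetilde A\succ0$; (b) $\operatorname{rank}M(-k_1+1,k_2-1)=\operatorname{rank}M(-k_1,k_2-1)=\operatorname{rank}M(-k_1,k_2-2)=\operatorname{rank}\widehat A$. Moreover, call $x_0\in\mathbb R$ *admissible* if $\beta(x_0)$ has a measure as in 4, and suppose that an admissible number exists. Let $$s=M(-k_1,k_2-1)\big/M(-k_1,k_2-2),\qquad t=\widehat A\big/M(-k_1,k_2-2),\qquad c=u\,M(-k_1,k_2-2)^\dagger w^T .$$ * (i) If $s=t=0$, then $x_0=c$ is the only admissible number. * (ii) Otherwise $s>0$, $t\ge0$, and the admissible numbers are exactly those of the two numbers $x_{0,\pm}=c\pm\sqrt{s\,t}$ that are not equal to $uC^{-1}u^T$ in case $C$ is invertible (if $C$ is not invertible, none of the two is excluded). * (iii) For every admissible $x_0$ the representing measure for $\beta(x_0)$ supported on $\mathbb R\setminus\{0\}$ is unique, and its support is the set of the real roots of the generating polynomial of $\beta(x_0)$. -/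

import Mathlib

open MeasureTheory Matrix

noncomputable section

namespace STHMP

/-! ### Moore--Penrose inverse and generalized Schur complement -/

/-- The four Penrose equations. -/
structure IsMoorePenrose {m n : Type} [Fintype m] [Fintype n]
    (A : Matrix m n ℝ) (X : Matrix n m ℝ) : Prop where
  mul_mul : A * X * A = A
  inv_mul_mul : X * A * X = X
  left_symm : (A * X)ᵀ = A * X
  right_symm : (X * A)ᵀ = X * A

theorem exists_symm_pinv {n : Type} [Fintype n] [DecidableEq n] (B : Matrix n n ℝ)
    (hB : B.IsHermitian) :
    ∃ Y : Matrix n n ℝ, Yᵀ = Y ∧ B * Y = Y * B ∧ B * Y * B = B ∧ Y * B * Y = Y := by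
  obtain ⟨U, V, d, hUV, hVU, hV, hBd⟩ : ∃ (U V : Matrix n n ℝ) (d : n → ℝ),
      U * V = 1 ∧ V * U = 1 ∧ V = Uᵀ ∧ B = U * diagonal d * V := by
    refine ⟨hB.eigenvectorUnitary, star (hB.eigenvectorUnitary : Matrix n n ℝ),
      hB.eigenvalues, by simp, by simp, ?_, ?_⟩
    · rw [star_eq_conjTranspose, conjTranspose_eq_transpose_of_trivial]
    · have h := hB.spectral_theorem
      rw [Unitary.conjStarAlgAut_apply] at h
      exact h
  have key : ∀ a b : n → ℝ, (U * diagonal a * V) * (U * diagonal b * V)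
      = U * diagonal (fun i => a i * b i) * V := by
    intro a b
    calc (U * diagonal a * V) * (U * diagonal b * V)
        = U * diagonal a * (V * U) * diagonal b * V := by simp only [Matrix.mul_assoc]
      _ = _ := by rw [hVU, Matrix.mul_one, Matrix.mul_assoc U, diagonal_mul_diagonal]
  refine ⟨U * diagonal (fun i => (d i)⁻¹) * V, ?_, ?_, ?_, ?_⟩
  · rw [hV]
    simp [Matrix.transpose_mul, Matrix.mul_assoc]
  · rw [hBd, key, key]
    simp only [mul_comm]
  · rw [hBd, key, key]
    simp only [mul_inv_mul_cancel]
  · rw [hBd, key, key]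
    congr 3
    ext i
    by_cases h : d i = 0 <;> simp [h]

theorem exists_isMoorePenrose {m n : Type} [Fintype m] [Fintype n] (A : Matrix m n ℝ) :
    ∃ X, IsMoorePenrose A X := by
  classical
  have hB : (Aᵀ * A).IsHermitian := by
    rw [IsHermitian, conjTranspose_eq_transpose_of_trivial]
    simp
  obtain ⟨Y, hY, hc, h1, h2⟩ := exists_symm_pinv (Aᵀ * A) hB
  refine ⟨Y * Aᵀ, ?_, ?_, ?_, ?_⟩
  · have h0 : (A * (Y * (Aᵀ * A)) - A)ᵀ * (A * (Y * (Aᵀ * A)) - A) = 0 := by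
      have e : A * (Y * (Aᵀ * A)) - A = A * (Y * (Aᵀ * A) - 1) := by
        rw [Matrix.mul_sub, Matrix.mul_one]
      have e2 : (Aᵀ * A) * (Y * (Aᵀ * A) - 1) = 0 := by
        rw [Matrix.mul_sub, Matrix.mul_one, ← Matrix.mul_assoc, h1, sub_self]
      rw [e, Matrix.transpose_mul, Matrix.mul_assoc, ← Matrix.mul_assoc Aᵀ, e2, Matrix.mul_zero]
    rw [← conjTranspose_eq_transpose_of_trivial, conjTranspose_mul_self_eq_zero] at h0
    have := sub_eq_zero.mp h0
    simpa [Matrix.mul_assoc] using this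
  · calc Y * Aᵀ * A * (Y * Aᵀ) = (Y * (Aᵀ * A) * Y) * Aᵀ := by simp only [Matrix.mul_assoc]
      _ = _ := by rw [h2]
  · simp [Matrix.transpose_mul, hY, Matrix.mul_assoc]
  · rw [Matrix.mul_assoc, Matrix.transpose_mul, hY, Matrix.transpose_mul,
      Matrix.transpose_transpose, hc]

/-- The Moore--Penrose inverse `A†` of a real matrix. -/
def pinv {m n : Type} [Fintype m] [Fintype n] (A : Matrix m n ℝ) : Matrix n m ℝ :=
  (exists_isMoorePenrose A).choose

theorem pinv_spec {m n : Type} [Fintype m] [Fintype n] (A : Matrix m n ℝ) :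
    IsMoorePenrose A (pinv A) :=
  (exists_isMoorePenrose A).choose_spec

/-- The symmetric matrix `[[A, b], [bᵀ, c]]`. -/
def bordered {n : Type} (A : Matrix n n ℝ) (b : n → ℝ) (c : ℝ) : Matrix (n ⊕ Unit) (n ⊕ Unit) ℝ :=
  fromBlocks A (replicateCol Unit b) (replicateRow Unit b) (of fun _ _ => c)

/-- The generalized Schur complement `M / A = D - C A† B` of the upper left block `A` in
`M = [[A, B], [C, D]]`. -/
def schurCompl {n m : Type} [Fintype n] [Fintype m] (M : Matrix (n ⊕ m) (n ⊕ m) ℝ) :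
    Matrix m m ℝ :=
  M.toBlocks₂₂ - M.toBlocks₂₁ * pinv M.toBlocks₁₁ * M.toBlocks₁₂

/-! ### Sequences `v = (v_0, …, v_{2k})`, stored as functions on `ℕ` of which only the values at
`0, …, 2k` are used -/

/-- The Hankel matrix `(v_{i+j})_{0 ≤ i, j < m}`. -/
def hankel (v : ℕ → ℝ) (m : ℕ) : Matrix (Fin m) (Fin m) ℝ :=
  of fun i j => v (i + j)

/-- The column `(v_j, …, v_{j+k})`. -/
def hankelCol (v : ℕ → ℝ) (k j : ℕ) : Fin (k + 1) → ℝ :=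
  fun l => v (j + l)

open Classical in
/-- The rank of the sequence `v`: it is `k + 1` if `A_v` is nonsingular, and otherwise the least `i`
such that the column `v_i` lies in the span of `v_0, …, v_{i-1}`. -/
def seqRank (v : ℕ → ℝ) (k : ℕ) : ℕ :=
  if (hankel v (k + 1)).det ≠ 0 then k + 1
  else sInf {i : ℕ | i ≤ k ∧
    hankelCol v k i ∈ Submodule.span ℝ (hankelCol v k '' {j : ℕ | j < i})}

/-- `v` is singular if its rank is less than `k + 1`. -/
def IsSingularSeq (v : ℕ → ℝ) (k : ℕ) : Prop :=
  seqRank v k < k + 1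

/-- The reversed sequence `(v_{2k}, …, v_0)`. -/
def revSeq (v : ℕ → ℝ) (k : ℕ) : ℕ → ℝ :=
  fun i => v (2 * k - i)

/-- `(φ_0, …, φ_{r-1}) = A_v(r-1)⁻¹ (v_r, …, v_{2r-1})ᵀ`. -/
def phi (v : ℕ → ℝ) (r : ℕ) : Fin r → ℝ :=
  (hankel v r)⁻¹ *ᵥ fun i => v (r + i)

/-- Positively recursively generated. -/
def IsPRG (v : ℕ → ℝ) (k : ℕ) : Prop :=
  let r := seqRank v k
  (hankel v r).PosDef ∧
    (r < k + 1 → ∀ j, r ≤ j → j ≤ 2 * k → v j = ∑ i : Fin r, phi v r i * v (j - r + i))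

/-- The lower right corner `(v_{i+j})_{k-r+1 ≤ i, j ≤ k}` of size `r ≤ k + 1`. -/
def hankelLower (v : ℕ → ℝ) (k r : ℕ) : Matrix (Fin r) (Fin r) ℝ :=
  of fun i j => v ((k + 1 - r + i) + (k + 1 - r + j))

/-- `(ψ_0, …, ψ_{r-1}) = A_v[r-1]⁻¹ (v_{2k-2r+1}, …, v_{2k-r})ᵀ` for `r ≤ k`. -/
def psi (v : ℕ → ℝ) (k r : ℕ) : Fin r → ℝ :=
  (hankelLower v k r)⁻¹ *ᵥ fun i => v (2 * k - 2 * r + 1 + i)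

/-- Negatively recursively generated. -/
def IsNRG (v : ℕ → ℝ) (k : ℕ) : Prop :=
  let r := seqRank (revSeq v k) k
  (hankelLower v k r).PosDef ∧
    (r < k + 1 → ∀ j, j ≤ 2 * k - r →
      v (2 * k - r - j) = ∑ i : Fin r, psi v k r i * v (2 * k - r - j + 1 + i))

/-- Recursively generated. -/
def IsRG (v : ℕ → ℝ) (k : ℕ) : Prop :=
  IsPRG v k ∧ IsNRG v k

/-- The generating polynomial `x^r - ∑_{i<r} φ_i x^i`, `r = rank v`, of a singular sequence. -/
def genPoly (v : ℕ → ℝ) (k : ℕ) : Polynomial ℝ :=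
  Polynomial.X ^ seqRank v k
    - ∑ i : Fin (seqRank v k), Polynomial.C (phi v (seqRank v k) i) * Polynomial.X ^ (i : ℕ)

/-! ### Partial matrices -/

/-- A partial matrix (unspecified entries are `none`) is partially positive semidefinite if it is
symmetric, also in the pattern of specified entries, and all its fully specified principal
submatrices are positive semidefinite. -/
def IsPartiallyPSD {n : Type} (A : Matrix n n (Option ℝ)) : Prop :=
  (∀ i j, A i j = A j i) ∧
    ∀ (S : Set n) (B : Matrix S S ℝ), (∀ i j : S, A i j = some (B i j)) → B.PosSemidef

/-! ### Two-sided sequences of degree `(-2k₁, 2k₂)`, stored as functions on `ℤ` of which only the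
values at `-2k₁, …, 2k₂` are used -/

/-- The moment matrix `M(n₁, n₂) = (β_{i+j})_{n₁ ≤ i, j ≤ n₂}` (empty if `n₂ < n₁`). -/
def M (β : ℤ → ℝ) (n₁ n₂ : ℤ) : Matrix (Set.Icc n₁ n₂) (Set.Icc n₁ n₂) ℝ :=
  of fun i j => β (i + j)

/-- `β(x)`: the entry of index `2k₂ - 1` is replaced by `x`. -/
def fill (β : ℤ → ℝ) (k₂ : ℕ) (x : ℝ) : ℤ → ℝ :=
  Function.update β (2 * k₂ - 1) x

/-- The partial Hankel matrix of `β` in which the moment of index `2k₂ - 1` is unspecified. -/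
def partialM (β : ℤ → ℝ) (k₁ k₂ : ℕ) :
    Matrix (Set.Icc (-(k₁ : ℤ)) (k₂ : ℤ)) (Set.Icc (-(k₁ : ℤ)) (k₂ : ℤ)) (Option ℝ) :=
  of fun i j => if (i : ℤ) + j = 2 * k₂ - 1 then none else some (β (i + j))

/-- `(γ_{-2k₁}, γ_{-2k₁+1}, …)` as a sequence starting at index `0`. -/
def shift (γ : ℤ → ℝ) (k₁ : ℕ) : ℕ → ℝ :=
  fun i => γ (-2 * k₁ + i)

/-- `μ` is a representing measure of `γ = (γ_{-2k₁}, …, γ_{2k₂})` supported on `ℝ ∖ {0}`. -/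
structure IsRepMeasure (γ : ℤ → ℝ) (k₁ k₂ : ℕ) (μ : Measure ℝ) : Prop where
  supp : μ {0} = 0
  integrable : ∀ i : ℤ, -2 * k₁ ≤ i → i ≤ 2 * k₂ → Integrable (fun x : ℝ => x ^ i) μ
  moment : ∀ i : ℤ, -2 * k₁ ≤ i → i ≤ 2 * k₂ → ∫ x : ℝ, x ^ i ∂μ = γ i

/-- `μ` is `m`-atomic: `μ = ∑ ρ_x δ_x` over `m` distinct points `x`, with densities `ρ_x > 0`. -/
def IsAtomic (μ : Measure ℝ) (m : ℕ) : Prop :=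
  ∃ (s : Finset ℝ) (ρ : ℝ → ℝ), s.card = m ∧ (∀ x ∈ s, 0 < ρ x) ∧
    μ = ∑ x ∈ s, ENNReal.ofReal (ρ x) • Measure.dirac x

/-- There is a `(rank M(-k₁, k₂-1))`-atomic representing measure of `β(x)` supported on
`ℝ ∖ {0}`. -/
def Admissible (β : ℤ → ℝ) (k₁ k₂ : ℕ) (x : ℝ) : Prop :=
  ∃ μ : Measure ℝ, IsRepMeasure (fill β k₂ x) k₁ k₂ μ ∧
    IsAtomic μ (M β (-k₁) (k₂ - 1)).rank

/-! ### The vectors and matrices attached to `β` -/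

/-- `(β_{-k₁+k₂+1}, …, β_{2k₂-2})`. -/
def vVec (β : ℤ → ℝ) (k₁ k₂ : ℕ) : Set.Icc (-(k₁ : ℤ) + 1) ((k₂ : ℤ) - 2) → ℝ :=
  fun i => β (k₂ + i)

/-- `(β_{-k₁+k₂}, …, β_{2k₂-2})`. -/
def uVec (β : ℤ → ℝ) (k₁ k₂ : ℕ) : Set.Icc (-(k₁ : ℤ)) ((k₂ : ℤ) - 2) → ℝ :=
  fun i => β (k₂ + i)

/-- `(β_{-k₁+k₂-1}, …, β_{2k₂-3})`. -/
def wVec (β : ℤ → ℝ) (k₁ k₂ : ℕ) : Set.Icc (-(k₁ : ℤ)) ((k₂ : ℤ) - 2) → ℝ :=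
  fun i => β (k₂ - 1 + i)

/-- `Ã = [[M(-k₁+1, k₂-2), vᵀ], [v, β_{2k₂}]]`. -/
def ATilde (β : ℤ → ℝ) (k₁ k₂ : ℕ) :=
  bordered (M β (-(k₁ : ℤ) + 1) ((k₂ : ℤ) - 2)) (vVec β k₁ k₂) (β (2 * k₂))

/-- `Â = [[M(-k₁, k₂-2), uᵀ], [u, β_{2k₂}]]`. -/
def AHat (β : ℤ → ℝ) (k₁ k₂ : ℕ) :=
  bordered (M β (-(k₁ : ℤ)) ((k₂ : ℤ) - 2)) (uVec β k₁ k₂) (β (2 * k₂))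

/-- `s = M(-k₁, k₂-1) / M(-k₁, k₂-2)`, where
`M(-k₁, k₂-1) = [[M(-k₁, k₂-2), wᵀ], [w, β_{2k₂-2}]]`. -/
def sVal (β : ℤ → ℝ) (k₁ k₂ : ℕ) : ℝ :=
  schurCompl (bordered (M β (-(k₁ : ℤ)) ((k₂ : ℤ) - 2)) (wVec β k₁ k₂) (β (2 * k₂ - 2))) () ()

/-- `t = Â / M(-k₁, k₂-2)`. -/
def tVal (β : ℤ → ℝ) (k₁ k₂ : ℕ) : ℝ :=
  schurCompl (AHat β k₁ k₂) () ()

/-- `u M(-k₁, k₂-2)† wᵀ`. -/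
def center (β : ℤ → ℝ) (k₁ k₂ : ℕ) : ℝ :=
  uVec β k₁ k₂ ⬝ᵥ (pinv (M β (-(k₁ : ℤ)) ((k₂ : ℤ) - 2)) *ᵥ wVec β k₁ k₂)

/-- `C = (β_{i+j+1})_{-k₁ ≤ i, j ≤ k₂-2}`. -/
def CMat (β : ℤ → ℝ) (k₁ k₂ : ℕ) :
    Matrix (Set.Icc (-(k₁ : ℤ)) ((k₂ : ℤ) - 2)) (Set.Icc (-(k₁ : ℤ)) ((k₂ : ℤ) - 2)) ℝ :=
  of fun i j => β (i + j + 1)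

/-- `C` is invertible and `x = u C⁻¹ uᵀ`; for positive definite `M(-k₁, k₂-1)` this is the value of
the missing moment for which `0` is an atom. -/
def IsExceptional (β : ℤ → ℝ) (k₁ k₂ : ℕ) (x : ℝ) : Prop :=
  IsUnit (CMat β k₁ k₂).det ∧
    x = uVec β k₁ k₂ ⬝ᵥ ((CMat β k₁ k₂)⁻¹ *ᵥ uVec β k₁ k₂)

end STHMP

end

noncomputable section

namespace STHMP

open Polynomial

/-! Put `k₁ + k₂ = m + 1`. Shifting indices by `2 * k₁` and replacing μ by x^(-2k₁) μ gives a
truncated Hamburger problem for a_0, …, a_{2m+2}, in which a_{2m+1} = x is the free datum and mass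
at 0 is forbidden. Matrix conditions become statements about the form L(f²), with L = `mom a` and f
restricted to certain exponents.

Projecting X^m and X^(m+1) off the polynomials of degree less than m leaves P and Q with Gram matrix
[[s, x - c], [x - c, t]] (`exists_isSchurPair_fill`), so x enters only off the diagonal. With at
most m + 1 atoms, the node polynomial, multiplied by a power of X if needed, is a monic polynomial
of degree m + 1 in the kernel of the form; this forces (x - c)² = st. Conversely, for a nonnegative
form such a kernel element produces atoms by Gauss quadrature (`exists_atomicMoments_of_kernel`).

It remains to keep 0 from being an atom. If M(-k₁, k₂-1) is positive definite, 0 is an atom for at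
most one value of x (`coeff_zero_eq_zero_iff`). For t > 0 there are two candidates and one survives;
for t = 0 the only candidate has node polynomial Q, and Ã ≻ 0 excludes Q(0) = 0. In the rank case s
= t = 0, and an atom at 0 would make the rank of M(-k₁+1, k₂-1) drop.

For necessity, a measure either has M(-k₁, k₂-1) positive definite, or annihilates the square of a
nonzero polynomial of degree at most m and so has at most m atoms; the ranks then count atoms by a
Vandermonde argument. Recursive generation is linked to atoms through the node polynomial: the
forward recursion yields quadrature, the backward one excludes 0. -/

/-! ### The moment functional of a sequence -/

/-- The linear functional on polynomials with `X ^ i ↦ a i`. -/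
def mom (a : ℕ → ℝ) : ℝ[X] →ₗ[ℝ] ℝ :=
  Polynomial.lsum fun i => a i • LinearMap.id

theorem mom_monomial (a : ℕ → ℝ) (i : ℕ) (c : ℝ) : mom a (monomial i c) = c * a i := by
  simp [mom, Polynomial.lsum, mul_comm]

theorem mom_X_pow (a : ℕ → ℝ) (i : ℕ) : mom a (X ^ i) = a i := by
  rw [X_pow_eq_monomial, mom_monomial, one_mul]

theorem mom_C_mul (a : ℕ → ℝ) (c : ℝ) (f : ℝ[X]) : mom a (C c * f) = c * mom a f := by
  rw [← smul_eq_C_mul, map_smul, smul_eq_mul]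

theorem mom_eq_sum (a : ℕ → ℝ) (f : ℝ[X]) (n : ℕ) (hf : f.natDegree < n) :
    mom a f = ∑ i ∈ Finset.range n, f.coeff i * a i := by
  conv_lhs => rw [f.as_sum_range' n hf]
  rw [map_sum]
  simp only [mom_monomial]

theorem mom_mul_eq_zero {a : ℕ → ℝ} {p : ℝ[X]} {n : ℕ} (h : ∀ i < n, mom a (p * X ^ i) = 0)
    {f : ℝ[X]} (hf : f.degree < n) : mom a (p * f) = 0 := by
  have hf' : ∀ i, n ≤ i → f.coeff i = 0 := degree_lt_iff_coeff_zero f n |>.mp hf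
  rw [f.as_sum_support, Finset.mul_sum, map_sum]
  refine Finset.sum_eq_zero fun i hi => ?_
  have hin : i < n := by
    by_contra hc
    exact (mem_support_iff.mp hi) (hf' i (not_lt.mp hc))
  rw [← C_mul_X_pow_eq_monomial, mul_left_comm, mom_C_mul, h i hin, mul_zero]

/-- Cauchy--Schwarz in the degenerate case: an isotropic vector of a nonnegative form is
orthogonal to everything. -/
theorem mom_mul_eq_zero_of_sq {a : ℕ → ℝ} {f g : ℝ[X]}
    (h : ∀ c : ℝ, 0 ≤ mom a ((g + C c * f) * (g + C c * f))) (hf : mom a (f * f) = 0) :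
    mom a (f * g) = 0 := by
  have key : ∀ c : ℝ, 0 ≤ mom a (g * g) + c * (2 * mom a (f * g)) := by
    intro c
    have e : (g + C c * f) * (g + C c * f)
        = g * g + C c * (f * g + f * g) + C c * (C c * (f * f)) := by ring
    have := h c
    rw [e, map_add, map_add, mom_C_mul, mom_C_mul, mom_C_mul, map_add, hf] at this
    linarith
  by_contra hne
  have := key (-(mom a (g * g) + 1) / (2 * mom a (f * g)))
  rw [div_mul_cancel₀ _ (mul_ne_zero two_ne_zero hne)] at this
  linarith

/-! ### Gram matrices of monomials -/

/-- The matrix `(a_{e i + e j})`. -/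
def gram {n : Type} (a : ℕ → ℝ) (e : n → ℕ) : Matrix n n ℝ :=
  of fun i j => a (e i + e j)

/-- The polynomial with coefficients `v` at the exponents `e`. -/
def expPoly {n : Type} [Fintype n] (e : n → ℕ) (v : n → ℝ) : ℝ[X] :=
  ∑ i, C (v i) * X ^ e i

theorem gram_isHermitian {n : Type} (a : ℕ → ℝ) (e : n → ℕ) : (gram a e).IsHermitian := by
  ext i j
  simp [gram, add_comm]

section Gram

variable {n : Type} [Fintype n] {e : n → ℕ}

theorem expPoly_coeff_of_notMem (v : n → ℝ) {j : ℕ} (hj : j ∉ Set.range e) :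
    (expPoly e v).coeff j = 0 := by
  simp only [expPoly, finsetSum_coeff, coeff_C_mul, coeff_X_pow]
  refine Finset.sum_eq_zero fun i _ => ?_
  rw [if_neg, mul_zero]
  rintro rfl
  exact hj ⟨i, rfl⟩

theorem expPoly_coeff (he : e.Injective) (v : n → ℝ) (i : n) :
    (expPoly e v).coeff (e i) = v i := by
  classical
  simp only [expPoly, finsetSum_coeff, coeff_C_mul, coeff_X_pow]
  rw [Finset.sum_eq_single i]
  · simp
  · intro j _ hj
    rw [if_neg fun h => hj (he h).symm, mul_zero]
  · simp

theorem expPoly_eq_of_support (he : e.Injective) {f : ℝ[X]}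
    (hf : ∀ j, j ∉ Set.range e → f.coeff j = 0) : expPoly e (fun i => f.coeff (e i)) = f := by
  ext j
  by_cases hj : j ∈ Set.range e
  · obtain ⟨i, rfl⟩ := hj
    rw [expPoly_coeff he]
  · rw [expPoly_coeff_of_notMem _ hj, hf j hj]

theorem expPoly_degree_lt {m : ℕ} (h : ∀ i, e i < m) (v : n → ℝ) :
    (expPoly e v).degree < m := by
  rw [degree_lt_iff_coeff_zero]
  intro j hj
  refine expPoly_coeff_of_notMem v ?_
  rintro ⟨i, rfl⟩
  exact absurd (h i) (not_lt.mpr hj)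

theorem expPoly_ne_zero (he : e.Injective) {v : n → ℝ} (hv : v ≠ 0) : expPoly e v ≠ 0 := by
  intro h
  refine hv (funext fun i => ?_)
  rw [← expPoly_coeff he v i, h, coeff_zero, Pi.zero_apply]

theorem dotProduct_expPoly (a : ℕ → ℝ) (v : n → ℝ) (f : ℝ[X]) :
    v ⬝ᵥ (fun i => mom a (X ^ e i * f)) = mom a (expPoly e v * f) := by
  simp only [expPoly, Finset.sum_mul, map_sum, dotProduct, mul_assoc, mom_C_mul]

theorem gram_mulVec (a : ℕ → ℝ) (v : n → ℝ) :
    gram a e *ᵥ v = fun i => mom a (X ^ e i * expPoly e v) := by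
  funext i
  simp only [mulVec, dotProduct, gram, of_apply, expPoly, Finset.mul_sum, map_sum]
  refine Finset.sum_congr rfl fun j _ => ?_
  rw [mul_left_comm, mom_C_mul, ← pow_add, mom_X_pow, mul_comm]

theorem gram_dotProduct (a : ℕ → ℝ) (v w : n → ℝ) :
    v ⬝ᵥ (gram a e *ᵥ w) = mom a (expPoly e v * expPoly e w) := by
  rw [gram_mulVec, dotProduct_expPoly]

/-- The exponent set may have gaps; this is what lets the bordered matrices Ã and Â and all fully
specified principal submatrices be treated alike. -/
theorem gram_posSemidef_iff (a : ℕ → ℝ) (he : e.Injective) :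
    (gram a e).PosSemidef ↔
      ∀ f : ℝ[X], (∀ j, j ∉ Set.range e → f.coeff j = 0) → 0 ≤ mom a (f * f) := by
  rw [posSemidef_iff_dotProduct_mulVec]
  constructor
  · rintro ⟨-, h⟩ f hf
    have := h fun i => f.coeff (e i)
    rwa [star_trivial, gram_dotProduct, expPoly_eq_of_support he hf] at this
  · intro h
    refine ⟨gram_isHermitian a e, fun v => ?_⟩
    rw [star_trivial, gram_dotProduct]
    exact h _ fun j hj => expPoly_coeff_of_notMem v hj

theorem gram_posDef_iff (a : ℕ → ℝ) (he : e.Injective) :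
    (gram a e).PosDef ↔
      ∀ f : ℝ[X], (∀ j, j ∉ Set.range e → f.coeff j = 0) → f ≠ 0 → 0 < mom a (f * f) := by
  rw [posDef_iff_dotProduct_mulVec]
  constructor
  · rintro ⟨-, h⟩ f hf hf0
    have hv : (fun i => f.coeff (e i)) ≠ 0 := by
      intro hv
      apply hf0
      rw [← expPoly_eq_of_support he hf, hv]
      simp [expPoly]
    have := h hv
    rwa [star_trivial, gram_dotProduct, expPoly_eq_of_support he hf] at this
  · intro h
    refine ⟨gram_isHermitian a e, fun v hv => ?_⟩
    rw [star_trivial, gram_dotProduct]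
    exact h _ (fun j hj => expPoly_coeff_of_notMem v hj) (expPoly_ne_zero he hv)

theorem gram_posDef_iff_degree (a : ℕ → ℝ) (he : e.Injective) {m : ℕ}
    (hm : Set.range e = Set.Iio m) :
    (gram a e).PosDef ↔ ∀ f : ℝ[X], f.degree < m → f ≠ 0 → 0 < mom a (f * f) := by
  rw [gram_posDef_iff a he]
  simp only [degree_lt_iff_coeff_zero, hm, Set.mem_Iio, not_lt]

end Gram

theorem hankel_eq_gram (a : ℕ → ℝ) (m : ℕ) : hankel a m = gram a (Fin.val : Fin m → ℕ) := rfl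

theorem hankel_posDef_iff (a : ℕ → ℝ) (m : ℕ) :
    (hankel a m).PosDef ↔ ∀ f : ℝ[X], f.degree < m → f ≠ 0 → 0 < mom a (f * f) :=
  gram_posDef_iff_degree a Fin.val_injective (by ext; simp)

/-! ### Finitely atomic moments and Gauss quadrature -/

/-- The numbers `a_0, …, a_N` are the moments of the atomic measure `∑ ρ_x δ_x`, `x ∈ s`. -/
structure AtomicMoments (a : ℕ → ℝ) (N : ℕ) (s : Finset ℝ) (ρ : ℝ → ℝ) : Prop where
  pos : ∀ x ∈ s, 0 < ρ x
  moment : ∀ j ≤ N, a j = ∑ x ∈ s, ρ x * x ^ j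

theorem AtomicMoments.mom_eq {a : ℕ → ℝ} {N : ℕ} {s : Finset ℝ} {ρ : ℝ → ℝ}
    (h : AtomicMoments a N s ρ) {f : ℝ[X]} (hf : f.natDegree ≤ N) :
    mom a f = ∑ x ∈ s, ρ x * f.eval x := by
  rw [mom_eq_sum a f (N + 1) (by omega)]
  simp only [eval_eq_sum_range' (show f.natDegree < N + 1 by omega), Finset.mul_sum]
  rw [Finset.sum_comm]
  refine Finset.sum_congr rfl fun i hi => ?_
  rw [h.moment i (by simpa [Nat.lt_succ_iff] using hi), Finset.mul_sum]
  exact Finset.sum_congr rfl fun x _ => by ring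

theorem AtomicMoments.sq_nonneg {a : ℕ → ℝ} {k : ℕ} {s : Finset ℝ} {ρ : ℝ → ℝ}
    (h : AtomicMoments a (2 * k) s ρ) {f : ℝ[X]} (hf : f.natDegree ≤ k) :
    0 ≤ mom a (f * f) := by
  rw [h.mom_eq (natDegree_mul_le.trans (by omega))]
  refine Finset.sum_nonneg fun x hx => mul_nonneg (h.pos x hx).le ?_
  rw [eval_mul]
  exact mul_self_nonneg _

theorem AtomicMoments.eval_eq_zero {a : ℕ → ℝ} {k : ℕ} {s : Finset ℝ} {ρ : ℝ → ℝ}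
    (h : AtomicMoments a (2 * k) s ρ) {f : ℝ[X]} (hf : f.natDegree ≤ k)
    (h0 : mom a (f * f) = 0) : ∀ x ∈ s, f.eval x = 0 := by
  rw [h.mom_eq (natDegree_mul_le.trans (by omega))] at h0
  simp only [eval_mul] at h0
  rw [Finset.sum_eq_zero_iff_of_nonneg
    fun x hx => mul_nonneg (h.pos x hx).le (mul_self_nonneg _)] at h0
  intro x hx
  have := (mul_eq_zero.mp (h0 x hx)).resolve_left (h.pos x hx).ne'
  exact mul_self_eq_zero.mp this

/-- The monic polynomial with simple zeros at the points of `s`. -/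
def nodePoly (s : Finset ℝ) : ℝ[X] := ∏ x ∈ s, (X - C x)

theorem nodePoly_monic (s : Finset ℝ) : (nodePoly s).Monic := monic_prod_X_sub_C _ _

theorem nodePoly_natDegree (s : Finset ℝ) : (nodePoly s).natDegree = s.card := by
  simp [nodePoly]

theorem nodePoly_eval_eq_zero (s : Finset ℝ) (x : ℝ) : (nodePoly s).eval x = 0 ↔ x ∈ s := by
  simp [nodePoly, eval_prod, Finset.prod_eq_zero_iff, sub_eq_zero]

theorem AtomicMoments.mom_nodePoly_mul {a : ℕ → ℝ} {N : ℕ} {s : Finset ℝ} {ρ : ℝ → ℝ}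
    (h : AtomicMoments a N s ρ) {f : ℝ[X]} (hf : s.card + f.natDegree ≤ N) :
    mom a (nodePoly s * f) = 0 := by
  rw [h.mom_eq (natDegree_mul_le.trans (by rwa [nodePoly_natDegree]))]
  refine Finset.sum_eq_zero fun x hx => ?_
  rw [eval_mul, (nodePoly_eval_eq_zero s x).mpr hx, zero_mul, mul_zero]

theorem eq_zero_of_eval_eq_zero {s : Finset ℝ} {f : ℝ[X]} (hf : f.degree < s.card)
    (h : ∀ x ∈ s, f.eval x = 0) : f = 0 :=
  eq_zero_of_degree_lt_of_eval_finset_eq_zero s hf h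

theorem AtomicMoments.sq_pos {a : ℕ → ℝ} {k : ℕ} {s : Finset ℝ} {ρ : ℝ → ℝ}
    (h : AtomicMoments a (2 * k) s ρ) (hs : s.card ≤ k) {f : ℝ[X]} (hf : f.degree < s.card)
    (hf0 : f ≠ 0) : 0 < mom a (f * f) := by
  have hd : f.natDegree ≤ k := by
    have := (natDegree_lt_iff_degree_lt hf0).mpr hf
    omega
  exact lt_of_le_of_ne (h.sq_nonneg hd) fun h0 =>
    hf0 (eq_zero_of_eval_eq_zero hf (h.eval_eq_zero hd h0.symm))

/-- Orthogonal polynomials have simple real zeros: if p = ((X - α)² + β²) g, then 0 = L(p g) = L(((X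
- α) g)²) + β² L(g²) > 0. A nonreal zero α + iβ and, with β = 0, a double zero both give such a
factor. -/
theorem exists_nodePoly_eq_of_orthogonal {a : ℕ → ℝ} {r : ℕ} {p : ℝ[X]} (hp : p.Monic)
    (hpr : p.natDegree = r) (horth : ∀ f : ℝ[X], f.degree < r → mom a (p * f) = 0)
    (hpos : ∀ f : ℝ[X], f.degree < r → f ≠ 0 → 0 < mom a (f * f)) :
    ∃ s : Finset ℝ, p = nodePoly s := by
  have hp0 := hp.ne_zero
  have key : ∀ α β : ℝ, ¬ ((X - C α) ^ 2 + C (β ^ 2) ∣ p) := by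
    rintro α β ⟨g, hg⟩
    have hquad : ((X - C α) ^ 2 + C (β ^ 2)).natDegree = 2 := by
      rw [natDegree_add_C, natDegree_pow, natDegree_X_sub_C]
    have hg0 : g ≠ 0 := by
      rintro rfl
      exact hp0 (by simpa using hg)
    have hq0 : ((X - C α) ^ 2 + C (β ^ 2)) ≠ 0 := by
      intro h
      rw [h, natDegree_zero] at hquad
      omega
    have hdeg : 2 + g.natDegree = r := by
      rw [← hpr, hg, natDegree_mul hq0 hg0, hquad]
    have hX0 : (X - C α) * g ≠ 0 := mul_ne_zero (X_sub_C_ne_zero α) hg0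
    have h1 : 0 < mom a (((X - C α) * g) * ((X - C α) * g)) := by
      refine hpos _ ?_ hX0
      rw [← natDegree_lt_iff_degree_lt hX0, natDegree_mul (X_sub_C_ne_zero α) hg0,
        natDegree_X_sub_C]
      omega
    have hgr : g.degree < r := by
      rw [← natDegree_lt_iff_degree_lt hg0]
      omega
    have h2 : 0 < mom a (g * g) := hpos _ hgr hg0
    have h3 : mom a (p * g) = 0 := horth g hgr
    have e : p * g = ((X - C α) * g) * ((X - C α) * g) + C (β ^ 2) * (g * g) := by
      rw [hg]; ring
    rw [e, map_add, mom_C_mul] at h3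
    nlinarith [sq_nonneg β]
  -- The cofactor q of the linear factors has no real root; were it nonconstant, a complex root
  -- would give a forbidden quadratic factor.
  obtain ⟨q, hq, hcard, hroots⟩ := exists_prod_multiset_X_sub_C_mul p
  have hqdvd : q ∣ p := ⟨_, by rw [mul_comm]; exact hq.symm⟩
  have hq0 : q ≠ 0 := fun h => hp0 (zero_dvd_iff.mp (h ▸ hqdvd))
  have hqdeg : q.natDegree = 0 := by
    by_contra hne
    have hdeg : (q.map (algebraMap ℝ ℂ)).degree ≠ 0 := by
      rw [degree_map, degree_eq_natDegree hq0]
      exact_mod_cast hne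
    obtain ⟨z, hz⟩ := IsAlgClosed.exists_root _ hdeg
    have hz' : aeval z q = 0 := by rwa [IsRoot, eval_map_algebraMap] at hz
    by_cases him : z.im = 0
    · have hre : (z.re : ℂ) = z := Complex.ext (by simp) (by simp [him])
      have : q.IsRoot z.re := by
        rw [← hre, ← Complex.coe_algebraMap, aeval_algebraMap_apply] at hz'
        simpa using hz'
      have hmem : z.re ∈ q.roots := (mem_roots hq0).mpr this
      rw [hroots] at hmem
      simp at hmem
    · have hd := Polynomial.quadratic_dvd_of_aeval_eq_zero_im_ne_zero q hz' him
      refine key z.re z.im ((dvd_of_eq ?_).trans (hd.trans hqdvd))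
      rw [← Complex.normSq_eq_norm_sq, Complex.normSq_apply]
      simp only [map_add, map_mul, map_pow, C_ofNat]
      ring
  have hnodup : p.roots.Nodup := by
    rw [Multiset.nodup_iff_count_le_one]
    intro α
    rw [count_roots]
    by_contra hc
    have h2 : (X - C α) ^ 2 ∣ p :=
      (pow_dvd_pow _ (by omega)).trans (pow_rootMultiplicity_dvd p α)
    exact key α 0 (by simpa using h2)
  refine ⟨p.roots.toFinset, ?_⟩
  have hcard' : p.roots.card = p.natDegree := by omega
  have := prod_multiset_X_sub_C_of_monic_of_roots_card_eq hp hcard'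
  rw [nodePoly, Finset.prod, Multiset.toFinset_val, hnodup.dedup, this]

/-- Gauss quadrature. -/
theorem exists_atomicMoments {a : ℕ → ℝ} {k r : ℕ} {p : ℝ[X]} (hr : r ≤ k) (hp : p.Monic)
    (hpr : p.natDegree = r) (horth : ∀ f : ℝ[X], f.natDegree ≤ 2 * k - r → mom a (p * f) = 0)
    (hpos : ∀ f : ℝ[X], f.degree < r → f ≠ 0 → 0 < mom a (f * f)) :
    ∃ (s : Finset ℝ) (ρ : ℝ → ℝ), p = nodePoly s ∧ AtomicMoments a (2 * k) s ρ := by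
  obtain ⟨s, rfl⟩ := exists_nodePoly_eq_of_orthogonal hp hpr
    (fun f hf => horth f (by
      by_cases hf0 : f = 0
      · simp [hf0]
      · have := (natDegree_lt_iff_degree_lt hf0).mpr hf
        omega)) hpos
  rw [nodePoly_natDegree] at hpr
  subst hpr
  have hinj : Set.InjOn (id : ℝ → ℝ) s := Function.injective_id.injOn
  -- These weights make the quadrature exact below degree |s|. Division by the node polynomial
  -- extends exactness to degree 2k, and testing on squares of Lagrange basis polynomials gives
  -- positivity.
  let ρ : ℝ → ℝ := fun x => mom a (Lagrange.basis s id x)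
  have hlow : ∀ f : ℝ[X], f.degree < s.card → mom a f = ∑ x ∈ s, ρ x * f.eval x := by
    intro f hf
    conv_lhs => rw [Lagrange.eq_interpolate hinj hf]
    rw [Lagrange.interpolate_apply, map_sum]
    refine Finset.sum_congr rfl fun x _ => ?_
    rw [mom_C_mul, mul_comm]
    rfl
  have hall : ∀ f : ℝ[X], f.natDegree ≤ 2 * k → mom a f = ∑ x ∈ s, ρ x * f.eval x := by
    intro f hf
    have hdec := modByMonic_add_div f (nodePoly s)
    have hdiv : (f /ₘ nodePoly s).natDegree ≤ 2 * k - s.card := by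
      rw [natDegree_divByMonic f hp, nodePoly_natDegree]
      omega
    have hmod : (f %ₘ nodePoly s).degree < s.card := by
      have := degree_modByMonic_lt f hp
      rwa [degree_eq_natDegree hp.ne_zero, nodePoly_natDegree] at this
    conv_lhs => rw [← hdec]
    rw [map_add, horth _ hdiv, add_zero, hlow _ hmod]
    refine Finset.sum_congr rfl fun x hx => ?_
    conv_rhs => rw [← hdec]
    rw [eval_add, eval_mul, (nodePoly_eval_eq_zero s x).mpr hx, zero_mul, add_zero]
  refine ⟨s, ρ, rfl, ⟨fun x hx => ?_, fun j hj => ?_⟩⟩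
  · have hdeg : (Lagrange.basis s id x).natDegree = s.card - 1 := Lagrange.natDegree_basis hinj hx
    have hne := Lagrange.basis_ne_zero hinj hx
    have hcard : 0 < s.card := Finset.card_pos.mpr ⟨x, hx⟩
    have h1 := hpos (Lagrange.basis s id x)
      (by rw [← natDegree_lt_iff_degree_lt hne]; omega) hne
    rw [hall _ (natDegree_mul_le.trans (by omega)), Finset.sum_eq_single x] at h1
    · have h2 := Lagrange.eval_basis_self hinj hx
      simp only [id] at h2
      rwa [eval_mul, h2, mul_one, mul_one] at h1
    · intro y hy hyx
      have h2 := Lagrange.eval_basis_of_ne (v := (id : ℝ → ℝ)) (Ne.symm hyx) hy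
      simp only [id] at h2
      rw [eval_mul, h2, mul_zero, mul_zero]
    · exact fun h => absurd hx h
  · rw [← mom_X_pow a j, hall _ (by simpa using hj)]
    simp

/-- A positive semidefinite Hankel form with a monic element of top degree in its kernel is
given by finitely many atoms. -/
theorem exists_atomicMoments_of_kernel {a : ℕ → ℝ} {k : ℕ}
    (hpsd : ∀ f : ℝ[X], f.natDegree ≤ k → 0 ≤ mom a (f * f))
    {q : ℝ[X]} (hq : q.Monic) (hqk : q.natDegree = k)
    (hker : ∀ f : ℝ[X], f.natDegree ≤ k → mom a (q * f) = 0) :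
    ∃ (s : Finset ℝ) (ρ : ℝ → ℝ), s.card ≤ k ∧ AtomicMoments a (2 * k) s ρ := by
  classical
  have hiso : ∀ f : ℝ[X], f.natDegree ≤ k → mom a (f * f) = 0 →
      ∀ g : ℝ[X], g.natDegree ≤ k → mom a (f * g) = 0 := by
    intro f hf h0 g hg
    refine mom_mul_eq_zero_of_sq (fun c => hpsd _ ?_) h0
    exact (natDegree_add_le _ _).trans (max_le hg ((natDegree_C_mul_le _ _).trans hf))
  -- An isotropic monic p of least degree d is the future node polynomial: minimality gives
  -- definiteness below degree d.
  let S : Set ℕ := {d | ∃ p : ℝ[X], p.Monic ∧ p.natDegree = d ∧ d ≤ k ∧ mom a (p * p) = 0}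
  have hS : ∃ d, d ∈ S := ⟨k, q, hq, hqk, le_rfl, hker q hqk.le⟩
  obtain ⟨p, hp, hpd, hdk, hp0⟩ := Nat.find_spec hS
  have hmin : ∀ m, m < Nat.find hS → m ∉ S := fun m hm => Nat.find_min hS hm
  generalize Nat.find hS = d at *
  have hpos : ∀ f : ℝ[X], f.degree < d → f ≠ 0 → 0 < mom a (f * f) := by
    intro f hf hf0
    have hfd := (natDegree_lt_iff_degree_lt hf0).mpr hf
    refine lt_of_le_of_ne (hpsd f (by omega)) fun h0 => ?_
    refine hmin _ hfd ⟨C f.leadingCoeff⁻¹ * f, ?_, ?_, by omega, ?_⟩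
    · rw [mul_comm]; exact monic_mul_leadingCoeff_inv hf0
    · rw [natDegree_C_mul (inv_ne_zero (leadingCoeff_ne_zero.mpr hf0))]
    · rw [mul_assoc, mom_C_mul, mul_left_comm, mom_C_mul, ← h0, mul_zero, mul_zero]
  have hdegp : ∀ j, (p * X ^ j).natDegree = d + j := fun j => by
    rw [hp.natDegree_mul (monic_X_pow j), natDegree_X_pow, hpd]
  -- If p X^j is in the kernel, then p X^(j+1) is isotropic, since its square is p X^j times p
  -- X^(j+2), of degree still at most k. This stops one short of degree k.
  have hstep : ∀ j, d + j + 1 ≤ k → ∀ f : ℝ[X], f.natDegree ≤ k →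
      mom a (p * X ^ j * f) = 0 := by
    intro j
    induction j with
    | zero =>
      intro _ f hf
      rw [pow_zero, mul_one]
      exact hiso p (by omega) hp0 f hf
    | succ j ih =>
      intro hj f hf
      refine hiso _ (by rw [hdegp]; omega) ?_ f hf
      have := ih (by omega) (X * (p * X ^ (j + 1)))
        (natDegree_mul_le.trans (by rw [natDegree_X, hdegp]; omega))
      rw [← this]
      congr 1
      ring
  -- The last multiple needs q: the difference q - p X^(k-d) has degree below k and is isotropic,
  -- hence lies in the kernel together with q.
  have htop : ∀ f : ℝ[X], f.natDegree ≤ k → mom a (p * X ^ (k - d) * f) = 0 := by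
    rcases hdk.eq_or_lt with hdk' | hdk'
    · intro f hf
      rw [hdk', Nat.sub_self, pow_zero, mul_one]
      exact hiso p (by omega) hp0 f hf
    have hlow : ∀ f : ℝ[X], f.natDegree + 1 ≤ k → mom a (p * X ^ (k - d) * f) = 0 := by
      intro f hf
      have := hstep (k - d - 1) (by omega) (X * f)
        (natDegree_mul_le.trans (by rw [natDegree_X]; omega))
      rw [← this, show k - d = (k - d - 1) + 1 by omega]
      congr 1
      simp only [Nat.add_sub_cancel]
      ring
    have hmon : (p * X ^ (k - d)).Monic := hp.mul (monic_X_pow _)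
    have hgd : (q - p * X ^ (k - d)).natDegree + 1 ≤ k := by
      by_cases hg0 : q - p * X ^ (k - d) = 0
      · rw [hg0, natDegree_zero]; omega
      have h1 : (q - p * X ^ (k - d)).degree < q.degree := by
        refine degree_sub_lt_left ?_ hq.ne_zero ?_
        · rw [degree_eq_natDegree hq.ne_zero, degree_eq_natDegree hmon.ne_zero, hdegp, hqk]
          congr 1; omega
        · rw [hq.leadingCoeff, hmon.leadingCoeff]
      rw [degree_eq_natDegree hq.ne_zero, hqk, ← natDegree_lt_iff_degree_lt hg0] at h1
      omega
    intro f hf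
    have h0 : mom a ((q - p * X ^ (k - d)) * (q - p * X ^ (k - d))) = 0 := by
      rw [sub_mul, map_sub, hker _ (by omega), hlow _ hgd, sub_zero]
    have h1 := hiso _ (by omega) h0 f hf
    rw [sub_mul, map_sub, hker f hf, zero_sub, neg_eq_zero] at h1
    exact h1
  have hall : ∀ i < 2 * k - d + 1, mom a (p * X ^ i) = 0 := by
    intro i hi
    rcases le_or_gt i k with hik | hik
    · have h1 := hiso p (by omega) hp0 (X ^ i) (by simpa using hik)
      exact h1
    · have h1 := htop (X ^ (i - (k - d))) (by rw [natDegree_X_pow]; omega)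
      rw [mul_assoc, ← pow_add, show k - d + (i - (k - d)) = i by omega] at h1
      exact h1
  obtain ⟨s, ρ, hps, hat⟩ := exists_atomicMoments hdk hp hpd
    (fun f hf => mom_mul_eq_zero hall (by
      rw [degree_lt_iff_coeff_zero]
      intro j hj
      exact coeff_eq_zero_of_natDegree_lt (by omega))) hpos
  refine ⟨s, ρ, ?_, hat⟩
  rw [← nodePoly_natDegree, ← hps]
  omega

/-! ### Ranks of Gram matrices of atomic moments -/

section Rank

variable {n : Type} [Fintype n] {e : n → ℕ} {a : ℕ → ℝ} {s : Finset ℝ} {ρ : ℝ → ℝ}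

/-- The matrix `(√ρ_x x ^ e_i)`. -/
def weightedVandermonde (e : n → ℕ) (s : Finset ℝ) (ρ : ℝ → ℝ) : Matrix s n ℝ :=
  of fun x i => √(ρ x) * (x : ℝ) ^ e i

theorem rank_gram_eq_rank_weightedVandermonde (hpos : ∀ x ∈ s, 0 < ρ x)
    (hmom : ∀ i j, a (e i + e j) = ∑ x ∈ s, ρ x * x ^ (e i + e j)) :
    (gram a e).rank = (weightedVandermonde e s ρ).rank := by
  have h : gram a e = (weightedVandermonde e s ρ)ᵀ * weightedVandermonde e s ρ := by
    ext i j
    rw [gram, of_apply, hmom, mul_apply, ← Finset.sum_coe_sort]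
    refine Finset.sum_congr rfl fun x _ => ?_
    simp only [weightedVandermonde, transpose_apply, of_apply]
    have := Real.mul_self_sqrt (hpos x x.2).le
    rw [pow_add]
    linear_combination (-(x : ℝ) ^ e i * (x : ℝ) ^ e j) * this
  rw [h, rank_transpose_mul_self]

theorem rank_gram_le_card (hpos : ∀ x ∈ s, 0 < ρ x)
    (hmom : ∀ i j, a (e i + e j) = ∑ x ∈ s, ρ x * x ^ (e i + e j)) :
    (gram a e).rank ≤ s.card := by
  rw [rank_gram_eq_rank_weightedVandermonde hpos hmom]
  simpa using rank_le_card_height (weightedVandermonde e s ρ)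

/-- Interpolation by X^m times a polynomial of degree less than |s| makes the weighted Vandermonde
matrix surjective. With m = 0 a node at 0 is allowed; with m = 1 the constant monomial is not
needed. -/
theorem rank_gram_eq_card (hpos : ∀ x ∈ s, 0 < ρ x)
    (hmom : ∀ i j, a (e i + e j) = ∑ x ∈ s, ρ x * x ^ (e i + e j)) (he : e.Injective) (m : ℕ)
    (hm : ∀ x ∈ s, x ^ m ≠ 0) (hrange : ∀ i < s.card, m + i ∈ Set.range e) :
    (gram a e).rank = s.card := by
  rw [rank_gram_eq_rank_weightedVandermonde hpos hmom, rank]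
  have hsurj : LinearMap.range (weightedVandermonde e s ρ).mulVecLin = ⊤ := by
    rw [LinearMap.range_eq_top]
    intro y
    -- The prescribed values are divided in advance by the factors √ρ_x and x^m that evaluation will
    -- restore.
    let y' : ℝ → ℝ := fun x => if h : x ∈ s then y ⟨x, h⟩ / (√(ρ x) * x ^ m) else 0
    let f : ℝ[X] := X ^ m * Lagrange.interpolate s id y'
    have hinj : Set.InjOn (id : ℝ → ℝ) s := Function.injective_id.injOn
    have hf : ∀ j, j ∉ Set.range e → f.coeff j = 0 := by
      intro j hj
      rw [coeff_X_pow_mul']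
      split_ifs with hmj
      · have hd := Lagrange.degree_interpolate_lt y' hinj
        rw [degree_lt_iff_coeff_zero] at hd
        refine hd _ ?_
        by_contra hc
        apply hj
        have := hrange (j - m) (by omega)
        rwa [Nat.add_sub_cancel' hmj] at this
      · rfl
    refine ⟨fun i => f.coeff (e i), ?_⟩
    funext x
    have h1 : (weightedVandermonde e s ρ).mulVecLin (fun i => f.coeff (e i)) x
        = √(ρ x) * f.eval (x : ℝ) := by
      conv_rhs => rw [← expPoly_eq_of_support he hf]
      simp only [mulVecLin_apply, mulVec, dotProduct, weightedVandermonde, of_apply, expPoly,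
        eval_finsetSum, eval_mul, eval_C, eval_pow, eval_X, Finset.mul_sum]
      exact Finset.sum_congr rfl fun i _ => by ring
    have h2 : (Lagrange.interpolate s id y').eval (x : ℝ) = y' x :=
      Lagrange.eval_interpolate_at_node y' hinj x.2
    have h3 := hm x x.2
    have h4 : √(ρ x) ≠ 0 := (Real.sqrt_pos.mpr (hpos x x.2)).ne'
    rw [h1, eval_mul, h2, eval_pow, eval_X]
    simp only [y', x.2, dif_pos, Subtype.coe_eta]
    field_simp
  rw [hsurj, finrank_top]
  simp

end Rank

theorem rank_gram_congr {n n' : Type} [Fintype n] [Fintype n'] (a : ℕ → ℝ) {e : n → ℕ}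
    {e' : n' → ℕ} (he : e.Injective) (he' : e'.Injective) (h : Set.range e = Set.range e') :
    (gram a e).rank = (gram a e').rank := by
  let σ : n ≃ n' := (Equiv.ofInjective e he).trans
    ((Equiv.setCongr h).trans (Equiv.ofInjective e' he').symm)
  have hσ : ∀ i, e' (σ i) = e i := fun i => by
    have := Equiv.apply_ofInjective_symm he' (Equiv.setCongr h (Equiv.ofInjective e he i))
    exact this
  have : gram a e = (gram a e').submatrix σ σ := by
    ext i j
    simp [gram, hσ]
  rw [this, rank_submatrix]

/-- If bordering a square matrix by one row and one column does not increase its rank, then the new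
column is a combination of the old ones. -/
theorem exists_mulVec_eq_zero_of_rank_eq {n : Type} [Fintype n] {B : Matrix (n ⊕ Unit) (n ⊕ Unit) ℝ}
    (h : B.rank = B.toBlocks₁₁.rank) : ∃ v : n → ℝ, B *ᵥ (Sum.elim v fun _ => 1) = 0 := by
  classical
  by_contra! hcon
  have hlast : ∀ z : n ⊕ Unit → ℝ, B *ᵥ z = 0 → z (Sum.inr ()) = 0 := by
    intro z hz
    by_contra hne
    refine hcon (fun i => (z (Sum.inr ()))⁻¹ * z (Sum.inl i)) ?_
    have : (Sum.elim (fun i => (z (Sum.inr ()))⁻¹ * z (Sum.inl i)) fun _ => 1)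
        = (z (Sum.inr ()))⁻¹ • z := by
      funext i
      rcases i with i | i
      · simp
      · simp [hne]
    rw [this, mulVec_smul, hz, smul_zero]
  have hcomp : ∀ z : n ⊕ Unit → ℝ, B *ᵥ z = 0 → B.toBlocks₁₁ *ᵥ (fun i => z (Sum.inl i)) = 0 := by
    intro z hz
    funext i
    have h1 := congrFun hz (Sum.inl i)
    have h2 := hlast z hz
    simp only [mulVec, dotProduct, Fintype.sum_sum_type] at h1
    simp only [mulVec, dotProduct, toBlocks₁₁, of_apply, Pi.zero_apply]
    simpa [h2] using h1
  -- If every kernel vector has last entry 0, the kernel of B embeds in that of the block. Equal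
  -- ranks make the nullity of B larger by one, a contradiction.
  let φ : LinearMap.ker B.mulVecLin →ₗ[ℝ] LinearMap.ker B.toBlocks₁₁.mulVecLin :=
    { toFun := fun z => ⟨fun i => z.1 (Sum.inl i), hcomp z.1 z.2⟩
      map_add' := fun _ _ => rfl
      map_smul' := fun _ _ => rfl }
  have hφ : Function.Injective φ := by
    rw [injective_iff_map_eq_zero]
    intro z hz
    ext i
    rcases i with i | i
    · exact congrFun (congrArg Subtype.val hz) i
    · exact hlast z.1 z.2
  have h1 := LinearMap.finrank_le_finrank_of_injective hφ
  have h2 := LinearMap.finrank_range_add_finrank_ker B.mulVecLin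
  have h3 := LinearMap.finrank_range_add_finrank_ker B.toBlocks₁₁.mulVecLin
  simp only [Module.finrank_fintype_fun_eq_card, Fintype.card_sum, Fintype.card_unit] at h2 h3
  unfold rank at h
  omega

/-! ### Rank of a sequence -/

theorem hankel_mulVec_coeff (a : ℕ → ℝ) {m : ℕ} {f : ℝ[X]} (hf : f.degree < m) :
    hankel a m *ᵥ (fun i : Fin m => f.coeff i) = fun i : Fin m => mom a (X ^ (i : ℕ) * f) := by
  have hs : ∀ j, j ∉ Set.range (Fin.val : Fin m → ℕ) → f.coeff j = 0 := fun j hj =>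
    (degree_lt_iff_coeff_zero f m).mp hf j (by simpa using hj)
  rw [hankel_eq_gram, gram_mulVec, expPoly_eq_of_support Fin.val_injective hs]

/-- The columns are images of monomials under f ↦ (L(f X^l))_l, so a dependence of column i on its
predecessors is a monic polynomial of degree i in the kernel. -/
theorem hankelCol_mem_span_iff (a : ℕ → ℝ) (k i : ℕ) :
    hankelCol a k i ∈ Submodule.span ℝ (hankelCol a k '' {j : ℕ | j < i}) ↔
      ∃ f : ℝ[X], f.degree < i ∧ ∀ l ≤ k, mom a ((X ^ i - f) * X ^ l) = 0 := by
  let T : ℝ[X] →ₗ[ℝ] (Fin (k + 1) → ℝ) :=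
    LinearMap.pi fun l => (mom a).comp (LinearMap.mulRight ℝ (X ^ (l : ℕ)))
  have hT : ∀ f l, T f l = mom a (f * X ^ (l : ℕ)) := fun f l => rfl
  have hcol : ∀ j, hankelCol a k j = T (X ^ j) := by
    intro j
    funext l
    rw [hT, ← pow_add, mom_X_pow]
    rfl
  have himg : Submodule.span ℝ (hankelCol a k '' {j : ℕ | j < i}) = (degreeLT ℝ i).map T := by
    rw [degreeLT_eq_span_X_pow, Submodule.map_span]
    congr 1
    ext z
    simp [hcol]
  rw [himg, Submodule.mem_map, hcol]
  refine exists_congr fun f => and_congr mem_degreeLT ?_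
  rw [eq_comm, ← sub_eq_zero, ← map_sub]
  constructor
  · intro h l hl
    exact congrFun h ⟨l, Nat.lt_succ_of_le hl⟩
  · intro h
    funext l
    exact h l (Nat.lt_succ_iff.mp l.2)

theorem seqRank_lt_of_det_eq_zero {a : ℕ → ℝ} {k : ℕ} (h : (hankel a (k + 1)).det = 0) :
    seqRank a k < k + 1 := by
  rw [seqRank, if_neg (not_not.mpr h)]
  rcases Set.eq_empty_or_nonempty {i : ℕ | i ≤ k ∧
    hankelCol a k i ∈ Submodule.span ℝ (hankelCol a k '' {j : ℕ | j < i})} with he | hne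
  -- By the convention `sInf ∅ = 0` no dependent column has to be exhibited.
  · rw [he, Nat.sInf_empty]
    omega
  · exact Nat.lt_succ_of_le (Nat.sInf_mem hne).1

/-! ### Atomic moments are singular and recursively generated -/

namespace AtomicMoments

variable {a : ℕ → ℝ} {k : ℕ} {s : Finset ℝ} {ρ : ℝ → ℝ}

theorem det_hankel_eq_zero (h : AtomicMoments a (2 * k) s ρ) (hs : s.card ≤ k) :
    (hankel a (k + 1)).det = 0 := by
  rw [← exists_mulVec_eq_zero_iff]
  refine ⟨fun i => (nodePoly s).coeff i, ?_, ?_⟩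
  · intro h0
    have := congrFun h0 ⟨s.card, by omega⟩
    have h1 := nodePoly_monic s
    rw [Monic, leadingCoeff, nodePoly_natDegree] at h1
    simp [h1] at this
  · rw [hankel_mulVec_coeff]
    · funext i
      rw [mul_comm, h.mom_nodePoly_mul (by rw [natDegree_X_pow]; omega)]
      rfl
    · rw [← natDegree_lt_iff_degree_lt (nodePoly_monic s).ne_zero, nodePoly_natDegree]
      omega

/-- The node polynomial gives a dependence at |s|. An earlier one would be a monic isotropic
polynomial of degree less than |s| vanishing at all nodes. -/
theorem seqRank_eq (h : AtomicMoments a (2 * k) s ρ) (hs : s.card ≤ k) :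
    seqRank a k = s.card := by
  rw [seqRank, if_neg (not_not.mpr (h.det_hankel_eq_zero hs))]
  refine IsLeast.csInf_eq ⟨⟨hs, ?_⟩, ?_⟩
  · rw [hankelCol_mem_span_iff]
    refine ⟨X ^ s.card - nodePoly s, ?_, fun l hl => ?_⟩
    · have h1 : (X ^ s.card - nodePoly s).degree < (X ^ s.card : ℝ[X]).degree := by
        refine degree_sub_lt_left ?_ (monic_X_pow _).ne_zero ?_
        · rw [degree_X_pow, degree_eq_natDegree (nodePoly_monic s).ne_zero, nodePoly_natDegree]
        · rw [(monic_X_pow _).leadingCoeff, (nodePoly_monic s).leadingCoeff]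
      rwa [degree_X_pow] at h1
    · rw [sub_sub_cancel]
      exact h.mom_nodePoly_mul (by rw [natDegree_X_pow]; omega)
  · rintro i ⟨hik, hi⟩
    rw [hankelCol_mem_span_iff] at hi
    obtain ⟨f, hf, hker⟩ := hi
    by_contra hlt
    rw [not_le] at hlt
    have hmon : (X ^ i - f).Monic := monic_X_pow_sub hf
    have hdeg : (X ^ i - f).degree = (i : WithBot ℕ) := by
      rw [degree_sub_eq_left_of_degree_lt (by rwa [degree_X_pow]), degree_X_pow]
    have hnat : (X ^ i - f).natDegree = i := natDegree_eq_of_degree_eq_some hdeg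
    have h0 : mom a ((X ^ i - f) * (X ^ i - f)) = 0 := by
      refine mom_mul_eq_zero (n := k + 1) (fun l hl => hker l (by omega)) ?_
      rw [hdeg]
      exact_mod_cast Nat.lt_succ_of_le hik
    refine hmon.ne_zero (eq_zero_of_eval_eq_zero (s := s) ?_ (h.eval_eq_zero (by omega) h0))
    rw [hdeg]
    exact_mod_cast hlt

theorem hankel_posDef (h : AtomicMoments a (2 * k) s ρ) (hs : s.card ≤ k) :
    (hankel a s.card).PosDef :=
  (hankel_posDef_iff a _).mpr fun _ hf hf0 => h.sq_pos hs hf hf0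

theorem phi_eq (h : AtomicMoments a (2 * k) s ρ) (hs : s.card ≤ k) :
    phi a s.card = fun i : Fin s.card => -(nodePoly s).coeff i := by
  have hdet : IsUnit (hankel a s.card).det := (h.hankel_posDef hs).det_pos.ne'.isUnit
  have hr : (fun i : Fin s.card => a (s.card + i))
      = hankel a s.card *ᵥ fun i : Fin s.card => -(nodePoly s).coeff i := by
    have hd : (X ^ s.card - nodePoly s).degree < (s.card : WithBot ℕ) := by
      have h1 : (X ^ s.card - nodePoly s).degree < (X ^ s.card : ℝ[X]).degree := by
        refine degree_sub_lt_left ?_ (monic_X_pow _).ne_zero ?_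
        · rw [degree_X_pow, degree_eq_natDegree (nodePoly_monic s).ne_zero, nodePoly_natDegree]
        · rw [(monic_X_pow _).leadingCoeff, (nodePoly_monic s).leadingCoeff]
      rwa [degree_X_pow] at h1
    have h2 := hankel_mulVec_coeff a hd
    have h3 : (fun i : Fin s.card => (X ^ s.card - nodePoly s).coeff i)
        = fun i : Fin s.card => -(nodePoly s).coeff i := by
      funext i
      rw [coeff_sub, coeff_X_pow, if_neg i.2.ne, zero_sub]
    rw [h3] at h2
    rw [h2]
    funext i
    rw [mul_sub, map_sub, mul_comm _ (nodePoly s),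
      h.mom_nodePoly_mul (by rw [natDegree_X_pow]; omega), sub_zero, ← pow_add, mom_X_pow, add_comm]
  rw [phi, hr, mulVec_mulVec, nonsing_inv_mul _ hdet, one_mulVec]

theorem nodePoly_eq_X_pow_sub (s : Finset ℝ) :
    nodePoly s = X ^ s.card - ∑ i : Fin s.card, C (-(nodePoly s).coeff i) * X ^ (i : ℕ) := by
  have h1 := (nodePoly_monic s).as_sum
  rw [nodePoly_natDegree] at h1
  conv_lhs => rw [h1]
  rw [Fin.sum_univ_eq_sum_range (fun i => C (-(nodePoly s).coeff i) * X ^ i), sub_eq_add_neg,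
    ← Finset.sum_neg_distrib]
  simp

theorem genPoly_eq (h : AtomicMoments a (2 * k) s ρ) (hs : s.card ≤ k) :
    genPoly a k = nodePoly s := by
  rw [genPoly, h.seqRank_eq hs, h.phi_eq hs, ← nodePoly_eq_X_pow_sub]

theorem isSingularSeq (h : AtomicMoments a (2 * k) s ρ) (hs : s.card ≤ k) :
    IsSingularSeq a k := by
  rw [IsSingularSeq, h.seqRank_eq hs]
  omega

theorem isPRG (h : AtomicMoments a (2 * k) s ρ) (hs : s.card ≤ k) : IsPRG a k := by
  suffices key : ∀ r, r = s.card → (hankel a r).PosDef ∧ (r < k + 1 → ∀ j, r ≤ j → j ≤ 2 * k →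
      a j = ∑ i : Fin r, phi a r i * a (j - r + i)) from key _ (h.seqRank_eq hs)
  rintro _ rfl
  refine ⟨h.hankel_posDef hs, fun _ j hj hjk => ?_⟩
  have h1 : mom a (nodePoly s * X ^ (j - s.card)) = 0 :=
    h.mom_nodePoly_mul (by rw [natDegree_X_pow]; omega)
  rw [nodePoly_eq_X_pow_sub, sub_mul, map_sub, ← pow_add, mom_X_pow, Nat.add_sub_cancel' hj,
    Finset.sum_mul, map_sum, sub_eq_zero] at h1
  rw [h1, h.phi_eq hs]
  refine Finset.sum_congr rfl fun i _ => ?_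
  rw [mul_assoc, mom_C_mul, ← pow_add, mom_X_pow, add_comm]

/-- Reversal is the substitution x ↦ 1/x with the weight ρ_x multiplied by x^(2k), which is positive
because no node is 0. -/
theorem revSeq (h : AtomicMoments a (2 * k) s ρ) (h0 : (0 : ℝ) ∉ s) :
    AtomicMoments (revSeq a k) (2 * k) (s.image fun x => x⁻¹)
      (fun x => ρ x⁻¹ * x⁻¹ ^ (2 * k)) := by
  refine ⟨fun y hy => ?_, fun j hj => ?_⟩
  · obtain ⟨x, hx, rfl⟩ := Finset.mem_image.mp hy
    have hx0 : x ≠ 0 := fun hc => h0 (hc ▸ hx)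
    rw [inv_inv]
    exact mul_pos (h.pos x hx) ((even_two_mul k).pow_pos hx0)
  · rw [Finset.sum_image (inv_injective.injOn), STHMP.revSeq, h.moment _ (by omega)]
    refine Finset.sum_congr rfl fun x hx => ?_
    have hx0 : x ≠ 0 := fun hc => h0 (hc ▸ hx)
    rw [inv_inv, mul_assoc, inv_pow, ← pow_sub₀ _ hx0 hj]

theorem isNRG (h : AtomicMoments a (2 * k) s ρ) (hs : s.card ≤ k) (h0 : (0 : ℝ) ∉ s) :
    IsNRG a k := by
  have hx0 : ∀ x ∈ s, x ≠ 0 := fun x hx hc => h0 (hc ▸ hx)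
  have hcard : (s.image fun x : ℝ => x⁻¹).card = s.card :=
    Finset.card_image_of_injective _ inv_injective
  have hrank : seqRank (STHMP.revSeq a k) k = s.card := by
    rw [(h.revSeq h0).seqRank_eq (by omega), hcard]
  -- The lower block tests the polynomials X^(k+1-|s|) g with deg g < |s|; at nonzero nodes the
  -- power of X can be cancelled.
  have hlow : (hankelLower a k s.card).PosDef := by
    have he : Function.Injective (fun i : Fin s.card => k + 1 - s.card + (i : ℕ)) := fun i j hij =>
      Fin.ext (by simpa using hij)
    refine (gram_posDef_iff a he).mpr fun f hf hf0 => ?_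
    have hfk : f.natDegree ≤ k := by
      refine natDegree_le_iff_coeff_eq_zero.mpr fun j hj => hf j ?_
      rintro ⟨i, rfl⟩
      have := i.2
      dsimp only at hj
      omega
    refine lt_of_le_of_ne (h.sq_nonneg hfk) fun hz => hf0 ?_
    have hev := h.eval_eq_zero hfk hz.symm
    have hdvd : X ^ (k + 1 - s.card) ∣ f := by
      rw [X_pow_dvd_iff]
      intro d hd
      refine hf d ?_
      rintro ⟨i, rfl⟩
      simp at hd
    obtain ⟨g, rfl⟩ := hdvd
    have hg : g = 0 := by
      refine eq_zero_of_eval_eq_zero (s := s) ?_ fun x hx => ?_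
      · rw [degree_lt_iff_coeff_zero]
        intro j hj
        have := hf (j + (k + 1 - s.card)) (by
          rintro ⟨i, hi⟩
          have := i.2
          simp only at hi
          omega)
        rwa [coeff_X_pow_mul] at this
      · have := hev x hx
        rw [eval_mul, eval_pow, eval_X] at this
        exact (mul_eq_zero.mp this).resolve_left (pow_ne_zero _ (hx0 x hx))
    rw [hg, mul_zero]
  have hc0 : (nodePoly s).coeff 0 ≠ 0 := by
    rw [coeff_zero_eq_eval_zero, Ne, nodePoly_eval_eq_zero]
    exact h0
  -- The backward recursion is the node equation solved for its constant term, which is nonzero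
  -- since 0 is not a node.
  let ψ : Fin s.card → ℝ := fun i => -(nodePoly s).coeff (i + 1) / (nodePoly s).coeff 0
  have hψ : ∀ x ∈ s, ∑ i, ψ i * x ^ ((i : ℕ) + 1) = 1 := by
    intro x hx
    have h1 := (nodePoly_eval_eq_zero s x).mpr hx
    rw [eval_eq_sum_range, nodePoly_natDegree, Finset.sum_range_succ'] at h1
    rw [Fin.sum_univ_eq_sum_range
      (fun i => -(nodePoly s).coeff (i + 1) / (nodePoly s).coeff 0 * x ^ (i + 1))]
    rw [← mul_left_inj' hc0, Finset.sum_mul, one_mul]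
    have h2 : ∀ i ∈ Finset.range s.card,
        -(nodePoly s).coeff (i + 1) / (nodePoly s).coeff 0 * x ^ (i + 1) * (nodePoly s).coeff 0
          = -((nodePoly s).coeff (i + 1) * x ^ (i + 1)) := by
      intro i _
      field_simp
    rw [Finset.sum_congr rfl h2, Finset.sum_neg_distrib]
    linear_combination -h1
  have hrec : ∀ m, m + s.card ≤ 2 * k → ∑ i, ψ i * a (m + 1 + i) = a m := by
    intro m hm
    rw [h.moment m (by omega)]
    have h1 : ∀ i : Fin s.card, ψ i * a (m + 1 + i)
        = ∑ x ∈ s, ρ x * x ^ m * (ψ i * x ^ ((i : ℕ) + 1)) := by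
      intro i
      have := i.2
      rw [h.moment _ (by omega), Finset.mul_sum]
      exact Finset.sum_congr rfl fun x _ => by ring
    rw [Finset.sum_congr rfl fun i _ => h1 i, Finset.sum_comm]
    refine Finset.sum_congr rfl fun x hx => ?_
    rw [← Finset.mul_sum, hψ x hx, mul_one]
  have hpsi : psi a k s.card = ψ := by
    have hdet : IsUnit (hankelLower a k s.card).det := hlow.det_pos.ne'.isUnit
    have : (fun i : Fin s.card => a (2 * k - 2 * s.card + 1 + i))
        = hankelLower a k s.card *ᵥ ψ := by
      funext l
      have := l.2
      rw [← hrec _ (by omega)]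
      simp only [mulVec, dotProduct, hankelLower, of_apply]
      refine Finset.sum_congr rfl fun i _ => ?_
      rw [mul_comm]
      congr 2
      omega
    rw [psi, this, mulVec_mulVec, nonsing_inv_mul _ hdet, one_mulVec]
  suffices key : ∀ r, r = s.card → (hankelLower a k r).PosDef ∧ (r < k + 1 → ∀ j, j ≤ 2 * k - r →
      a (2 * k - r - j) = ∑ i : Fin r, psi a k r i * a (2 * k - r - j + 1 + i)) from key _ hrank
  rintro _ rfl
  rw [hpsi]
  exact ⟨hlow, fun _ j hj => (hrec _ (by omega)).symm⟩

end AtomicMoments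

/-! ### From recursive generation to atoms away from 0 -/

/-- A singular positively recursively generated sequence consists of atomic moments. -/
theorem IsPRG.exists_atomicMoments {a : ℕ → ℝ} {k : ℕ} (h : IsPRG a k) (hs : IsSingularSeq a k) :
    ∃ (s : Finset ℝ) (ρ : ℝ → ℝ), s.card ≤ k ∧ AtomicMoments a (2 * k) s ρ := by
  obtain ⟨hpd, hrec⟩ := h
  rw [IsSingularSeq] at hs
  have hgen : genPoly a k
      = X ^ seqRank a k - expPoly (Fin.val : Fin (seqRank a k) → ℕ) (phi a (seqRank a k)) := rfl
  have hlt : (expPoly (Fin.val : Fin (seqRank a k) → ℕ) (phi a (seqRank a k))).degree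
      < (seqRank a k : ℕ) := expPoly_degree_lt (fun i => i.2) _
  have hdeg : (genPoly a k).natDegree = seqRank a k := by
    refine natDegree_eq_of_degree_eq_some ?_
    rw [hgen, degree_sub_eq_left_of_degree_lt (by rwa [degree_X_pow]), degree_X_pow]
  have hmon : (genPoly a k).Monic := by
    rw [hgen]
    exact monic_X_pow_sub hlt
  obtain ⟨s, ρ, hp, hat⟩ := STHMP.exists_atomicMoments (k := k) (by omega) hmon hdeg
    (fun f hf => mom_mul_eq_zero (n := 2 * k - seqRank a k + 1) (fun i hi => by
      have h1 := hrec hs (seqRank a k + i) (by omega) (by omega)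
      rw [Nat.add_sub_cancel_left] at h1
      rw [hgen, sub_mul, map_sub, ← pow_add, mom_X_pow, h1, expPoly, Finset.sum_mul, map_sum,
        sub_eq_zero]
      refine Finset.sum_congr rfl fun j _ => ?_
      rw [mul_assoc, mom_C_mul, ← pow_add, mom_X_pow, add_comm])
      (by
        rw [degree_lt_iff_coeff_zero]
        intro j hj
        exact coeff_eq_zero_of_natDegree_lt (by omega)))
    ((hankel_posDef_iff a _).mp hpd)
  refine ⟨s, ρ, ?_, hat⟩
  rw [← nodePoly_natDegree, ← hp, hdeg]
  omega

/-- The backward recursion gives q with q(0) = 1 and L(q f) = 0 for all f of degree at most 2k - r.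
Were 0 a node, its Lagrange basis polynomial as f would give ρ_0 = 0. -/
theorem IsNRG.zero_notMem {a : ℕ → ℝ} {k : ℕ} {s : Finset ℝ} {ρ : ℝ → ℝ} (h : IsNRG a k)
    (hat : AtomicMoments a (2 * k) s ρ) (hs : s.card ≤ k) : (0 : ℝ) ∉ s := by
  intro h0
  have hdet : (hankel (revSeq a k) (k + 1)).det = 0 := by
    have : hankel (revSeq a k) (k + 1)
        = (hankel a (k + 1)).submatrix Fin.revPerm Fin.revPerm := by
      ext i j
      have := i.2
      have := j.2
      simp only [hankel, revSeq, of_apply, submatrix_apply, Fin.revPerm_apply, Fin.val_rev]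
      congr 1
      omega
    rw [this, det_submatrix_equiv_self, hat.det_hankel_eq_zero hs]
  have hr := seqRank_lt_of_det_eq_zero hdet
  obtain ⟨-, hrec⟩ := h
  generalize seqRank (revSeq a k) k = r at *
  have hrec := hrec hr
  let q : ℝ[X] := 1 - ∑ i : Fin r, C (psi a k r i) * X ^ ((i : ℕ) + 1)
  have hq : ∀ n < 2 * k - r + 1, mom a (q * X ^ n) = 0 := by
    intro n hn
    have h1 := hrec (2 * k - r - n) (by omega)
    rw [show 2 * k - r - (2 * k - r - n) = n by omega] at h1
    rw [sub_mul, one_mul, map_sub, mom_X_pow, h1, Finset.sum_mul, map_sum, sub_eq_zero]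
    refine Finset.sum_congr rfl fun i _ => ?_
    rw [mul_assoc, mom_C_mul, ← pow_add, mom_X_pow]
    congr 2
    omega
  have hqd : q.natDegree ≤ r := by
    refine (natDegree_sub_le _ _).trans (max_le (by simp) ?_)
    refine natDegree_sum_le_of_forall_le _ _ fun i _ => ?_
    refine (natDegree_C_mul_X_pow_le _ _).trans ?_
    have := i.2
    omega
  have hq0 : q.eval 0 = 1 := by
    simp [q, eval_finsetSum]
  have hinj : Set.InjOn (id : ℝ → ℝ) s := Function.injective_id.injOn
  have hld : (Lagrange.basis s id (0 : ℝ)).natDegree = s.card - 1 :=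
    Lagrange.natDegree_basis hinj h0
  have h1 : mom a (q * Lagrange.basis s id (0 : ℝ)) = 0 := by
    refine mom_mul_eq_zero hq ?_
    rw [degree_lt_iff_coeff_zero]
    intro j hj
    exact coeff_eq_zero_of_natDegree_lt (by omega)
  rw [hat.mom_eq (natDegree_mul_le.trans (by omega)), Finset.sum_eq_single 0] at h1
  · have h2 := Lagrange.eval_basis_self hinj h0
    simp only [id] at h2
    rw [eval_mul, hq0, h2, mul_one, mul_one] at h1
    exact (hat.pos 0 h0).ne' h1
  · intro y hy hyx
    have h2 := Lagrange.eval_basis_of_ne (v := (id : ℝ → ℝ)) (Ne.symm hyx) hy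
    simp only [id] at h2
    rw [eval_mul, h2, mul_zero, mul_zero]
  · exact fun h => absurd h0 h

/-! ### Reduction to a 2 × 2 Gram matrix by Schur complements -/

theorem mulVec_pinv_mulVec {n : Type} [Fintype n] {A : Matrix n n ℝ} (hA : Aᵀ = A) {w : n → ℝ}
    (hw : ∀ v, A *ᵥ v = 0 → w ⬝ᵥ v = 0) : A *ᵥ (pinv A *ᵥ w) = w := by
  have hX := pinv_spec A
  generalize pinv A = Y at *
  have hsymm := hX.left_symm
  have h1 : A * (A * Y) = A := by
    have := congrArg transpose hX.mul_mul
    rwa [transpose_mul, hsymm, hA] at this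
  have h2 : A *ᵥ (w - A *ᵥ (Y *ᵥ w)) = 0 := by
    rw [mulVec_sub, mulVec_mulVec, mulVec_mulVec, Matrix.mul_assoc, h1, sub_self]
  have h3 := hw _ h2
  have h4 : (A *ᵥ (Y *ᵥ w)) ⬝ᵥ (w - A *ᵥ (Y *ᵥ w)) = 0 := by
    rw [dotProduct_comm, dotProduct_mulVec, ← mulVec_transpose, hA, h2, zero_dotProduct]
  have h5 : (w - A *ᵥ (Y *ᵥ w)) ⬝ᵥ (w - A *ᵥ (Y *ᵥ w)) = 0 := by
    rw [sub_dotProduct, h3, h4, sub_zero]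
  exact (sub_eq_zero.mp (dotProduct_self_eq_zero.mp h5)).symm

/-- Monic polynomials of degrees `m` and `m + 1` orthogonal to all polynomials of degree less than
`m`, with Gram matrix `[[s, δ], [δ, t]]`. -/
structure IsSchurPair (a : ℕ → ℝ) (m : ℕ) (s t δ : ℝ) (P Q : ℝ[X]) : Prop where
  sub_left : (X ^ m - P).degree < (m : WithBot ℕ)
  sub_right : (X ^ (m + 1) - Q).degree < (m : WithBot ℕ)
  orth_left : ∀ g : ℝ[X], g.degree < m → mom a (P * g) = 0
  orth_right : ∀ g : ℝ[X], g.degree < m → mom a (Q * g) = 0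
  left_left : mom a (P * P) = s
  right_right : mom a (Q * Q) = t
  left_right : mom a (P * Q) = δ

/-- The Moore–Penrose inverse supplies the projections of X^m and X^(m+1) even when the leading
block is singular: isotropic vectors are orthogonal to both monomials by Cauchy–Schwarz, so the
linear systems are solvable. The two positivity hypotheses never use X^m and X^(m+1) together, hence
do not involve a_{2m+1}. -/
theorem exists_isSchurPair {n : Type} [Fintype n] {e : n → ℕ} {a : ℕ → ℝ} {m : ℕ}
    (hm : Set.range e = Set.Iio m)
    (h1 : ∀ f : ℝ[X], f.degree < (m + 1 : ℕ) → 0 ≤ mom a (f * f))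
    (h2 : ∀ f : ℝ[X], f.natDegree ≤ m + 1 → f.coeff m = 0 → 0 ≤ mom a (f * f)) :
    ∃ P Q : ℝ[X], IsSchurPair a m
      (a (2 * m) - (fun i => a (e i + m)) ⬝ᵥ (pinv (gram a e) *ᵥ fun i => a (e i + m)))
      (a (2 * m + 2)
        - (fun i => a (e i + (m + 1))) ⬝ᵥ (pinv (gram a e) *ᵥ fun i => a (e i + (m + 1))))
      (a (2 * m + 1) - (fun i => a (e i + (m + 1))) ⬝ᵥ (pinv (gram a e) *ᵥ fun i => a (e i + m)))
      P Q := by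
  have hlt : ∀ i, e i < m := fun i => by
    have : e i ∈ Set.range e := ⟨i, rfl⟩
    rwa [hm] at this
  have hsymm : (gram a e)ᵀ = gram a e := by
    have := gram_isHermitian a e
    rwa [IsHermitian, conjTranspose_eq_transpose_of_trivial] at this
  have hdot : ∀ (v : n → ℝ) d, (fun i => a (e i + d)) ⬝ᵥ v = mom a (expPoly e v * X ^ d) := by
    intro v d
    rw [dotProduct_comm, ← dotProduct_expPoly]
    simp only [← pow_add, mom_X_pow]
  have hdeg := fun v => expPoly_degree_lt hlt v
  have hcoef : ∀ v j, m ≤ j → (expPoly e v).coeff j = 0 := fun v =>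
    (degree_lt_iff_coeff_zero _ _).mp (hdeg v)
  have hker : ∀ v, gram a e *ᵥ v = 0 → mom a (expPoly e v * expPoly e v) = 0 := by
    intro v hv
    rw [← gram_dotProduct, hv, dotProduct_zero]
  have hw := mulVec_pinv_mulVec hsymm (w := fun i => a (e i + m)) fun v hv => by
    rw [hdot]
    refine mom_mul_eq_zero_of_sq (fun c => h1 _ ?_) (hker v hv)
    rw [degree_lt_iff_coeff_zero]
    intro j hj
    rw [coeff_add, coeff_C_mul, coeff_X_pow, hcoef v j (by omega), if_neg (by omega)]
    simp
  have hu := mulVec_pinv_mulVec hsymm (w := fun i => a (e i + (m + 1))) fun v hv => by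
    rw [hdot]
    refine mom_mul_eq_zero_of_sq (fun c => h2 _ ?_ ?_) (hker v hv)
    · rw [natDegree_le_iff_coeff_eq_zero]
      intro j hj
      rw [coeff_add, coeff_C_mul, coeff_X_pow, hcoef v j (by omega), if_neg (by omega)]
      simp
    · rw [coeff_add, coeff_C_mul, coeff_X_pow, hcoef v m le_rfl, if_neg (by omega)]
      simp
  set y := pinv (gram a e) *ᵥ fun i => a (e i + m)
  set z := pinv (gram a e) *ᵥ fun i => a (e i + (m + 1))
  have horth : ∀ (v : n → ℝ) d, gram a e *ᵥ v = (fun i => a (e i + d)) →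
      ∀ g : ℝ[X], g.degree < m → mom a ((X ^ d - expPoly e v) * g) = 0 := by
    intro v d hv g hg
    refine mom_mul_eq_zero (fun i hi => ?_) hg
    have : i ∈ Set.range e := by rw [hm]; exact hi
    obtain ⟨i, rfl⟩ := this
    have := congrFun hv i
    rw [gram_mulVec] at this
    dsimp only at this
    rw [mul_comm, mul_sub, map_sub, this, ← pow_add, mom_X_pow, sub_self]
  refine ⟨X ^ m - expPoly e y, X ^ (m + 1) - expPoly e z, ?_, ?_, horth y m hw,
    horth z (m + 1) hu, ?_, ?_, ?_⟩
  · rw [sub_sub_cancel]; exact hdeg y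
  · rw [sub_sub_cancel]; exact hdeg z
  · rw [mul_sub, map_sub, horth y m hw _ (hdeg y), sub_zero, sub_mul, map_sub, ← pow_add,
      mom_X_pow, hdot, two_mul]
  · rw [mul_sub, map_sub, horth z _ hu _ (hdeg z), sub_zero, sub_mul, map_sub, ← pow_add,
      mom_X_pow, hdot, show m + 1 + (m + 1) = 2 * m + 2 by ring]
  · rw [mul_sub, map_sub, horth y m hw _ (hdeg z), sub_zero, sub_mul, map_sub, ← pow_add,
      mom_X_pow, hdot, show m + (m + 1) = 2 * m + 1 by ring]

namespace IsSchurPair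

variable {a : ℕ → ℝ} {m : ℕ} {s t δ : ℝ} {P Q : ℝ[X]}

theorem coeff_left (h : IsSchurPair a m s t δ P Q) {j : ℕ} (hj : m ≤ j) :
    P.coeff j = if j = m then 1 else 0 := by
  have := (degree_lt_iff_coeff_zero _ _).mp h.sub_left j hj
  rw [coeff_sub, coeff_X_pow] at this
  linarith

theorem coeff_right (h : IsSchurPair a m s t δ P Q) {j : ℕ} (hj : m ≤ j) :
    Q.coeff j = if j = m + 1 then 1 else 0 := by
  have := (degree_lt_iff_coeff_zero _ _).mp h.sub_right j hj
  rw [coeff_sub, coeff_X_pow] at this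
  linarith

theorem natDegree_left (h : IsSchurPair a m s t δ P Q) : P.natDegree ≤ m :=
  natDegree_le_iff_coeff_eq_zero.mpr fun j hj => by rw [h.coeff_left (by omega), if_neg (by omega)]

theorem left_ne_zero (h : IsSchurPair a m s t δ P Q) : P ≠ 0 := by
  intro hP
  have := h.coeff_left le_rfl
  rw [hP, if_pos rfl, coeff_zero] at this
  exact zero_ne_one this

theorem comb_natDegree (h : IsSchurPair a m s t δ P Q) (c : ℝ) :
    (Q - C c * P).natDegree = m + 1 ∧ (Q - C c * P).Monic := by
  have hle : (Q - C c * P).natDegree ≤ m + 1 := by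
    refine natDegree_le_iff_coeff_eq_zero.mpr fun j hj => ?_
    rw [coeff_sub, coeff_C_mul, h.coeff_right (by omega), h.coeff_left (by omega),
      if_neg (by omega), if_neg (by omega)]
    simp
  have h1 : (Q - C c * P).coeff (m + 1) = 1 := by
    rw [coeff_sub, coeff_C_mul, h.coeff_right (by omega), h.coeff_left (by omega), if_pos rfl,
      if_neg (by omega)]
    simp
  exact ⟨natDegree_eq_of_le_of_coeff_ne_zero hle (by rw [h1]; exact one_ne_zero),
    monic_of_natDegree_le_of_coeff_eq_one _ hle h1⟩

theorem exists_decomp (h : IsSchurPair a m s t δ P Q) {f : ℝ[X]} (hf : f.natDegree ≤ m + 1) :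
    ∃ g : ℝ[X], g.degree < m ∧ f = g + C (f.coeff m) * P + C (f.coeff (m + 1)) * Q := by
  refine ⟨f - C (f.coeff m) * P - C (f.coeff (m + 1)) * Q, ?_, by ring⟩
  rw [degree_lt_iff_coeff_zero]
  intro j hj
  rw [coeff_sub, coeff_sub, coeff_C_mul, coeff_C_mul, h.coeff_left hj, h.coeff_right hj]
  rcases Nat.lt_or_ge (m + 1) j with hj' | hj'
  · rw [coeff_eq_zero_of_natDegree_lt (by omega), if_neg (by omega), if_neg (by omega)]
    simp
  · obtain rfl | rfl : j = m ∨ j = m + 1 := by omega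
    · simp
    · simp

theorem mom_sq (h : IsSchurPair a m s t δ P Q) {g : ℝ[X]} (hg : g.degree < m) (α β : ℝ) :
    mom a ((g + C α * P + C β * Q) * (g + C α * P + C β * Q))
      = mom a (g * g) + (α ^ 2 * s + 2 * α * β * δ + β ^ 2 * t) := by
  have e : (g + C α * P + C β * Q) * (g + C α * P + C β * Q)
      = g * g + C (2 * α) * (P * g) + C (2 * β) * (Q * g) + C (α ^ 2) * (P * P)
        + C (2 * α * β) * (P * Q) + C (β ^ 2) * (Q * Q) := by
    simp only [map_mul, map_pow, C_ofNat]
    ring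
  rw [e]
  simp only [map_add, mom_C_mul]
  rw [h.orth_left g hg, h.orth_right g hg, h.left_left, h.right_right, h.left_right]
  ring

theorem mom_sq_nonneg (h : IsSchurPair a m s t δ P Q)
    (hpsd : ∀ g : ℝ[X], g.degree < m → 0 ≤ mom a (g * g)) (hs : 0 ≤ s) (ht : 0 ≤ t)
    (hδ : δ ^ 2 ≤ s * t) {f : ℝ[X]} (hf : f.natDegree ≤ m + 1) : 0 ≤ mom a (f * f) := by
  obtain ⟨g, hg, hfg⟩ := h.exists_decomp hf
  rw [hfg, h.mom_sq hg]
  refine add_nonneg (hpsd g hg) ?_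
  generalize f.coeff m = α
  generalize f.coeff (m + 1) = β
  rcases hs.eq_or_lt with h0 | h0
  · have hδ0 : δ = 0 := by
      rw [← h0, zero_mul] at hδ
      exact pow_eq_zero_iff two_ne_zero |>.mp (le_antisymm hδ (sq_nonneg δ))
    rw [← h0, hδ0]
    nlinarith [mul_nonneg (sq_nonneg β) ht]
  · refine nonneg_of_mul_nonneg_right (a := s) ?_ h0
    nlinarith [sq_nonneg (α * s + β * δ), mul_nonneg (sq_nonneg β) (sub_nonneg.mpr hδ)]

theorem sq_le_mul (h : IsSchurPair a m s t δ P Q)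
    (hpsd : ∀ f : ℝ[X], f.natDegree ≤ m + 1 → 0 ≤ mom a (f * f)) :
    0 ≤ s ∧ 0 ≤ t ∧ δ ^ 2 ≤ s * t := by
  have key : ∀ α β : ℝ, 0 ≤ α ^ 2 * s + 2 * α * β * δ + β ^ 2 * t := by
    intro α β
    have h1 := h.mom_sq (g := 0) (by simp) α β
    simp only [mul_zero, map_zero, zero_add] at h1
    rw [← h1]
    refine hpsd _ (natDegree_le_iff_coeff_eq_zero.mpr fun j hj => ?_)
    simp only [coeff_add, coeff_C_mul]
    rw [h.coeff_left (by omega), h.coeff_right (by omega), if_neg (by omega), if_neg (by omega)]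
    simp
  have hs : 0 ≤ s := by simpa using key 1 0
  have ht : 0 ≤ t := by simpa using key 0 1
  refine ⟨hs, ht, ?_⟩
  rcases hs.eq_or_lt with h0 | h0
  · rw [← h0, zero_mul]
    by_contra hne
    have hδ : δ ≠ 0 := by
      rintro rfl
      exact hne (by simp)
    -- With s = 0 the form is linear in α; this α makes it equal to -1.
    have h1 := key (-(t + 1) / (2 * δ)) 1
    rw [← h0, show 2 * (-(t + 1) / (2 * δ)) * 1 * δ = -(t + 1) by field_simp] at h1
    linarith
  · have h1 := key (-δ) s
    have h2 : 0 ≤ s * (s * t - δ ^ 2) := by nlinarith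
    have := nonneg_of_mul_nonneg_right h2 h0
    linarith

/-- The hypotheses say that (-c, 1) is a kernel vector of [[s, δ], [δ, t]]. -/
theorem comb_mul_eq_zero (h : IsSchurPair a m s t δ P Q) {c : ℝ} (h1 : c * s = δ)
    (h2 : c * δ = t) {f : ℝ[X]} (hf : f.natDegree ≤ m + 1) : mom a ((Q - C c * P) * f) = 0 := by
  obtain ⟨g, hg, hfg⟩ := h.exists_decomp hf
  generalize f.coeff m = α at *
  generalize f.coeff (m + 1) = β at *
  have e : (Q - C c * P) * f = Q * g + C α * (P * Q) + C β * (Q * Q)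
      - C c * (P * g + C α * (P * P) + C β * (P * Q)) := by
    rw [hfg]; ring
  rw [e]
  simp only [map_add, map_sub, mom_C_mul]
  rw [h.orth_left g hg, h.orth_right g hg, h.left_left, h.right_right, h.left_right]
  linear_combination -α * h1 - β * h2

/-- With at most `m` atoms both Schur complements vanish. -/
theorem eq_zero_of_card_le (h : IsSchurPair a m s t δ P Q) {S : Finset ℝ} {ρ : ℝ → ℝ}
    (hat : AtomicMoments a (2 * (m + 1)) S ρ) (hS : S.card ≤ m) : s = 0 ∧ t = 0 := by
  have hpsd := h.sq_le_mul fun f hf => hat.sq_nonneg hf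
  have hnode : ∀ d, (nodePoly S * X ^ d).natDegree = S.card + d := fun d => by
    rw [(nodePoly_monic S).natDegree_mul (monic_X_pow d), natDegree_X_pow, nodePoly_natDegree]
  have hmon : ∀ d, (nodePoly S * X ^ d).Monic := fun d => (nodePoly_monic S).mul (monic_X_pow d)
  have hker : ∀ d f, S.card + d ≤ m + 1 → f.natDegree ≤ m + 1 →
      mom a (nodePoly S * X ^ d * f) = 0 := by
    intro d f hd hf
    rw [mul_assoc]
    refine hat.mom_nodePoly_mul ?_
    have := natDegree_mul_le (p := X ^ d) (q := f)
    rw [natDegree_X_pow] at this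
    omega
  -- The form splits into the part of degree less than m, which is nonnegative, and the 2 × 2 part.
  -- Multiples of the node polynomial that are monic of degree m, then m + 1, isolate s, then t.
  have hcomp : ∀ f : ℝ[X], f.natDegree ≤ m + 1 → mom a (f * f) = 0 →
      (f.coeff m) ^ 2 * s + 2 * f.coeff m * f.coeff (m + 1) * δ + (f.coeff (m + 1)) ^ 2 * t
        ≤ 0 := by
    intro f hf h0
    obtain ⟨g, hg, hfg⟩ := h.exists_decomp hf
    have h1 := h.mom_sq hg (f.coeff m) (f.coeff (m + 1))
    rw [← hfg, h0] at h1
    have h2 : 0 ≤ mom a (g * g) := hat.sq_nonneg (by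
      by_cases hg0 : g = 0
      · simp [hg0]
      · have := (natDegree_lt_iff_degree_lt hg0).mpr hg
        omega)
    linarith
  have hlead : ∀ d, (nodePoly S * X ^ d).coeff (S.card + d) = 1 := fun d => by
    rw [← hnode d]
    exact (hmon d).coeff_natDegree
  have hs0 : s = 0 := by
    have h1 := hcomp (nodePoly S * X ^ (m - S.card)) (by rw [hnode]; omega)
      (hker _ _ (by omega) (by rw [hnode]; omega))
    have h2 := hlead (m - S.card)
    rw [Nat.add_sub_cancel' hS] at h2
    rw [h2, coeff_eq_zero_of_natDegree_lt (by rw [hnode]; omega)] at h1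
    linarith [hpsd.1]
  refine ⟨hs0, ?_⟩
  have hδ0 : δ = 0 := by
    have := hpsd.2.2
    rw [hs0, zero_mul] at this
    exact pow_eq_zero_iff two_ne_zero |>.mp (le_antisymm this (sq_nonneg δ))
  have h1 := hcomp (nodePoly S * X ^ (m + 1 - S.card)) (by rw [hnode]; omega)
    (hker _ _ (by omega) (by rw [hnode]; omega))
  have h2 := hlead (m + 1 - S.card)
  rw [Nat.add_sub_cancel' (by omega)] at h2
  rw [h2, hs0, hδ0] at h1
  linarith [hpsd.2.1]

/-- If the Gram matrix of the pair is singular, then the moments are atomic. -/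
theorem exists_atomicMoments (h : IsSchurPair a m s t δ P Q)
    (hpsd : ∀ g : ℝ[X], g.degree < m → 0 ≤ mom a (g * g)) (hs : 0 ≤ s) {c : ℝ} (h1 : c * s = δ)
    (h2 : c * δ = t) :
    ∃ (S : Finset ℝ) (ρ : ℝ → ℝ), S.card ≤ m + 1 ∧ AtomicMoments a (2 * (m + 1)) S ρ := by
  have ht : t = c ^ 2 * s := by rw [← h2, ← h1]; ring
  refine exists_atomicMoments_of_kernel (fun f hf => h.mom_sq_nonneg hpsd hs ?_ ?_ hf)
    (h.comb_natDegree c).2 (h.comb_natDegree c).1 fun f hf => h.comb_mul_eq_zero h1 h2 hf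
  · rw [ht]; positivity
  · rw [ht, ← h1]
    exact le_of_eq (by ring)

end IsSchurPair

/-! ### Positive definite leading part -/

section PosDef

variable {a : ℕ → ℝ} {m : ℕ}

theorem eq_of_monic_orthogonal
    (hpd : ∀ f : ℝ[X], f.degree < (m + 1 : ℕ) → f ≠ 0 → 0 < mom a (f * f)) {p q : ℝ[X]}
    (hp : p.Monic) (hq : q.Monic) (hpd' : p.natDegree = m + 1) (hqd : q.natDegree = m + 1)
    (hpo : ∀ i < m + 1, mom a (p * X ^ i) = 0) (hqo : ∀ i < m + 1, mom a (q * X ^ i) = 0) :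
    p = q := by
  by_contra hne
  have hd : (p - q).degree < (m + 1 : ℕ) := by
    have := degree_sub_lt_left (p := p) (q := q)
      (by rw [degree_eq_natDegree hp.ne_zero, degree_eq_natDegree hq.ne_zero, hpd', hqd])
      hp.ne_zero (by rw [hp.leadingCoeff, hq.leadingCoeff])
    rwa [degree_eq_natDegree hp.ne_zero, hpd'] at this
  have h0 : mom a ((p - q) * (p - q)) = 0 :=
    mom_mul_eq_zero (fun i hi => by rw [sub_mul, map_sub, hpo i hi, hqo i hi, sub_zero]) hd
  exact (hpd _ hd (sub_ne_zero.mpr hne)).ne' h0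

theorem AtomicMoments.card_eq
    (hpd : ∀ f : ℝ[X], f.degree < (m + 1 : ℕ) → f ≠ 0 → 0 < mom a (f * f))
    {S : Finset ℝ} {ρ : ℝ → ℝ} (hat : AtomicMoments a (2 * (m + 1)) S ρ) (hS : S.card ≤ m + 1) :
    S.card = m + 1 := by
  by_contra hne
  have h0 := (nodePoly_monic S).ne_zero
  refine (hpd (nodePoly S) ?_ h0).ne' (hat.mom_nodePoly_mul ?_)
  · rw [← natDegree_lt_iff_degree_lt h0, nodePoly_natDegree]
    omega
  · rw [nodePoly_natDegree]
    omega

/-- The monic polynomial of degree `m + 1` orthogonal to all polynomials of lower degree vanishes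
at `0` exactly for the exceptional value of `a_{2m+1}`. -/
theorem coeff_zero_eq_zero_iff {n : Type} [Fintype n] [DecidableEq n] {e : n → ℕ}
    (he : e.Injective) (hm : Set.range e = Set.Iio m)
    (hpd : ∀ f : ℝ[X], f.degree < (m + 1 : ℕ) → f ≠ 0 → 0 < mom a (f * f)) {p : ℝ[X]}
    (hp : p.Monic) (hpd' : p.natDegree = m + 1) (hpo : ∀ i < m + 1, mom a (p * X ^ i) = 0) :
    p.coeff 0 = 0 ↔ IsUnit (gram (fun j => a (j + 1)) e).det ∧
      a (2 * m + 1) = (fun i => a (e i + (m + 1))) ⬝ᵥ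
        ((gram (fun j => a (j + 1)) e)⁻¹ *ᵥ fun i => a (e i + (m + 1))) := by
  set K := gram (fun j => a (j + 1)) e with hK
  set u : n → ℝ := fun i => a (e i + (m + 1)) with hu
  -- C is the Gram matrix of the form L(X f g). For p = X (X^m + v), orthogonality to X^i with i < m
  -- reads C v = -u, and orthogonality to X^m reads a_{2m+1} = -u·v.
  have hmom : ∀ f, mom (fun j => a (j + 1)) f = mom a (X * f) := by
    intro f
    induction f using Polynomial.induction_on' with
    | add p q hp hq => rw [mul_add, map_add, map_add, hp, hq]
    | monomial i c => rw [mom_monomial, X_mul_monomial, mom_monomial]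
  have hlt : ∀ i, e i < m := fun i => by
    have : e i ∈ Set.range e := ⟨i, rfl⟩
    rwa [hm] at this
  have hKmul : ∀ v i, (K *ᵥ v) i = mom a (X * (X ^ e i * expPoly e v)) := fun v i => by
    rw [hK, gram_mulVec]
    exact hmom _
  have hsymm : Kᵀ = K := by
    have := gram_isHermitian (fun j => a (j + 1)) e
    rwa [IsHermitian, conjTranspose_eq_transpose_of_trivial] at this
  have hudot : ∀ v, u ⬝ᵥ v = mom a (X * expPoly e v * X ^ m) := by
    intro v
    have h1 := dotProduct_expPoly (e := e) a v (X ^ (m + 1))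
    simp only [← pow_add, mom_X_pow] at h1
    rw [dotProduct_comm, h1]
    congr 1
    ring
  have horth : ∀ v, K *ᵥ v = -u → a (2 * m + 1) = -(u ⬝ᵥ v) → ∀ i < m + 1,
      mom a (X * (X ^ m + expPoly e v) * X ^ i) = 0 := by
    intro v hv hx i hi
    have e1 : X * (X ^ m + expPoly e v) * X ^ i
        = X ^ (i + (m + 1)) + X * (X ^ i * expPoly e v) := by ring
    rw [e1, map_add, mom_X_pow]
    rcases Nat.lt_succ_iff_lt_or_eq.mp hi with hi' | rfl
    · have : i ∈ Set.range e := by rw [hm]; exact hi'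
      obtain ⟨i, rfl⟩ := this
      rw [← hKmul, hv]
      simp [hu]
    · rw [hudot] at hx
      rw [show i + (i + 1) = 2 * i + 1 by ring, hx, neg_add_eq_zero]
      congr 1
      ring
  constructor
  · intro h0
    obtain ⟨g, rfl⟩ := X_dvd_iff.mpr h0
    have hg : g.Monic := monic_X.of_mul_monic_left hp
    have hgd : g.natDegree = m := by
      rw [monic_X.natDegree_mul hg, natDegree_X] at hpd'
      omega
    have hgs : (g - X ^ m).degree < (m : WithBot ℕ) := by
      have := degree_sub_lt_left (p := g) (q := X ^ m)
        (by rw [degree_eq_natDegree hg.ne_zero, hgd, degree_X_pow])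
        hg.ne_zero (by rw [hg.leadingCoeff, leadingCoeff_X_pow])
      rwa [degree_eq_natDegree hg.ne_zero, hgd] at this
    set q : n → ℝ := fun i => (g - X ^ m).coeff (e i) with hq
    have hqe : expPoly e q = g - X ^ m := expPoly_eq_of_support he fun j hj => by
      refine (degree_lt_iff_coeff_zero _ _).mp hgs j ?_
      rw [hm] at hj
      simpa using hj
    have hKq : K *ᵥ q = -u := by
      funext i
      rw [hKmul, hqe]
      have h1 := hpo (e i) (by have := hlt i; omega)
      have e1 : X * (X ^ e i * (g - X ^ m)) = X * g * X ^ e i - X ^ (e i + (m + 1)) := by ring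
      rw [e1, map_sub, h1, mom_X_pow, zero_sub]
      rfl
    have hx : a (2 * m + 1) = -(u ⬝ᵥ q) := by
      rw [hudot, hqe]
      have h1 := hpo m (by omega)
      have e1 : X * (g - X ^ m) * X ^ m = X * g * X ^ m - X ^ (2 * m + 1) := by ring
      rw [e1, map_sub, h1, mom_X_pow, zero_sub, neg_neg]
    -- A kernel vector v of C is orthogonal to u, which lies in the range of C. Then X v is
    -- orthogonal to all polynomials of degree at most m, itself included, against definiteness.
    have hdet : IsUnit K.det := by
      rw [isUnit_iff_ne_zero]
      intro hdet
      obtain ⟨v, hv0, hv⟩ := exists_mulVec_eq_zero_iff.mpr hdet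
      have huv : u ⬝ᵥ v = 0 := by
        have h1 : (K *ᵥ q) ⬝ᵥ v = 0 := by
          rw [dotProduct_comm, dotProduct_mulVec, ← mulVec_transpose, hsymm, hv, zero_dotProduct]
        rwa [hKq, neg_dotProduct, neg_eq_zero] at h1
      have hne := expPoly_ne_zero he hv0
      have hXne : X * expPoly e v ≠ 0 := mul_ne_zero X_ne_zero hne
      have hXd : (X * expPoly e v : ℝ[X]).degree < ((m + 1 : ℕ) : WithBot ℕ) := by
        rw [← natDegree_lt_iff_degree_lt hXne, natDegree_X_mul hne]
        have := (natDegree_lt_iff_degree_lt hne).mpr (expPoly_degree_lt hlt v)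
        omega
      refine (hpd _ hXd hXne).ne' (mom_mul_eq_zero (fun i hi => ?_) hXd)
      rcases Nat.lt_succ_iff_lt_or_eq.mp hi with hi' | rfl
      · have : i ∈ Set.range e := by rw [hm]; exact hi'
        obtain ⟨i, rfl⟩ := this
        have h1 := hKmul v i
        rw [hv] at h1
        rw [mul_assoc, mul_comm (expPoly e v), ← h1]
        rfl
      · rw [← hudot, huv]
    refine ⟨hdet, ?_⟩
    have : K⁻¹ *ᵥ u = -q := by
      rw [← neg_neg u, ← hKq, mulVec_neg, mulVec_mulVec, nonsing_inv_mul _ hdet, one_mulVec]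
    rw [this, dotProduct_neg, hx]
  · rintro ⟨hdet, hx⟩
    have hv : K *ᵥ (-(K⁻¹ *ᵥ u)) = -u := by
      rw [mulVec_neg, mulVec_mulVec, mul_nonsing_inv _ hdet, one_mulVec]
    have ho := horth _ hv (by rw [dotProduct_neg, neg_neg, hx])
    have hdl : (expPoly e (-(K⁻¹ *ᵥ u))).degree < m := expPoly_degree_lt hlt _
    have hmon : (X ^ m + expPoly e (-(K⁻¹ *ᵥ u))).Monic := monic_X_pow_add hdl
    have hnat : (X ^ m + expPoly e (-(K⁻¹ *ᵥ u))).natDegree = m := by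
      refine natDegree_eq_of_degree_eq_some ?_
      rw [degree_add_eq_left_of_degree_lt (by rwa [degree_X_pow]), degree_X_pow]
    rw [eq_of_monic_orthogonal hpd hp (monic_X.mul hmon) hpd'
      (by rw [monic_X.natDegree_mul hmon, natDegree_X, hnat, add_comm]) hpo ho, mul_coeff_zero,
      coeff_X_zero, zero_mul]

end PosDef

/-! ### Uniqueness of atomic representations -/

theorem AtomicMoments.weight_eq {a : ℕ → ℝ} {k : ℕ} {s : Finset ℝ} {ρ : ℝ → ℝ}
    (h : AtomicMoments a (2 * k) s ρ) (hs : s.card ≤ k) {x : ℝ} (hx : x ∈ s) :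
    ρ x = mom a (Lagrange.basis s id x) := by
  have hinj : Set.InjOn (id : ℝ → ℝ) s := Function.injective_id.injOn
  rw [h.mom_eq (by rw [Lagrange.natDegree_basis hinj hx]; omega), Finset.sum_eq_single x]
  · have h2 := Lagrange.eval_basis_self hinj hx
    simp only [id] at h2
    rw [h2, mul_one]
  · intro y hy hyx
    have h2 := Lagrange.eval_basis_of_ne (v := (id : ℝ → ℝ)) (Ne.symm hyx) hy
    simp only [id] at h2
    rw [h2, mul_zero]
  · exact fun h => absurd hx h

/-- Both node polynomials equal the generating polynomial, which depends on the moments alone; the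
weights are then L of the Lagrange basis. -/
theorem AtomicMoments.unique {a : ℕ → ℝ} {k : ℕ} {s s' : Finset ℝ} {ρ ρ' : ℝ → ℝ}
    (h : AtomicMoments a (2 * k) s ρ) (h' : AtomicMoments a (2 * k) s' ρ') (hs : s.card ≤ k)
    (hs' : s'.card ≤ k) : s' = s ∧ ∀ x ∈ s, ρ' x = ρ x := by
  have hss : s' = s := by
    ext x
    rw [← nodePoly_eval_eq_zero, ← nodePoly_eval_eq_zero, ← h.genPoly_eq hs, ← h'.genPoly_eq hs']
  subst hss
  exact ⟨rfl, fun x hx => by rw [h.weight_eq hs hx, h'.weight_eq hs hx]⟩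

/-! ### Atomic measures -/

/-- The measure `∑ c_x δ_x`, `x ∈ s`. -/
def atomicMeasure (s : Finset ℝ) (c : ℝ → ℝ) : Measure ℝ :=
  ∑ x ∈ s, ENNReal.ofReal (c x) • Measure.dirac x

theorem atomicMeasure_congr {s : Finset ℝ} {c d : ℝ → ℝ} (h : ∀ x ∈ s, c x = d x) :
    atomicMeasure s c = atomicMeasure s d :=
  Finset.sum_congr rfl fun x hx => by rw [h x hx]

theorem atomicMeasure_apply (s : Finset ℝ) (c : ℝ → ℝ) {t : Set ℝ} (ht : MeasurableSet t) :
    atomicMeasure s c t = ∑ x ∈ s, ENNReal.ofReal (c x) * t.indicator 1 x := by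
  rw [atomicMeasure, Measure.finsetSum_apply]
  refine Finset.sum_congr rfl fun x _ => ?_
  rw [Measure.smul_apply, Measure.dirac_apply' _ ht, smul_eq_mul]

theorem integrable_atomicMeasure (s : Finset ℝ) (c : ℝ → ℝ) (f : ℝ → ℝ) :
    Integrable f (atomicMeasure s c) := by
  rw [atomicMeasure, integrable_finsetSum_measure]
  intro x _
  exact (integrable_dirac (by simp)).smul_measure ENNReal.ofReal_ne_top

theorem integral_atomicMeasure {s : Finset ℝ} {c : ℝ → ℝ} (hc : ∀ x ∈ s, 0 < c x) (f : ℝ → ℝ) :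
    ∫ x, f x ∂(atomicMeasure s c) = ∑ x ∈ s, c x * f x := by
  rw [atomicMeasure, integral_finsetSum_measure]
  · refine Finset.sum_congr rfl fun x hx => ?_
    rw [integral_smul_measure, integral_dirac, ENNReal.toReal_ofReal (hc x hx).le, smul_eq_mul]
  · intro x _
    exact (integrable_dirac (by simp)).smul_measure ENNReal.ofReal_ne_top

theorem support_atomicMeasure {s : Finset ℝ} {c : ℝ → ℝ} (hc : ∀ x ∈ s, 0 < c x) :
    (atomicMeasure s c).support = s := by
  refine Set.Subset.antisymm ?_ ?_
  · refine Measure.support_subset_of_isClosed s.finite_toSet.isClosed ?_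
    rw [mem_ae_iff, atomicMeasure_apply _ _ s.measurableSet.compl]
    refine Finset.sum_eq_zero fun x hx => ?_
    rw [Set.indicator_of_notMem (by simpa using hx), mul_zero]
  · intro x hx
    rw [Measure.mem_support_iff_forall]
    intro U hU
    refine lt_of_lt_of_le ?_ (measure_mono (Set.singleton_subset_iff.mpr (mem_of_mem_nhds hU)))
    rw [atomicMeasure_apply _ _ (measurableSet_singleton x)]
    refine lt_of_lt_of_le ?_ (Finset.single_le_sum (fun _ _ => zero_le) hx)
    simpa using hc x hx

theorem eq_atomicMeasure (μ : Measure ℝ) [IsFiniteMeasure μ] {s : Finset ℝ}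
    (hs : μ (s : Set ℝ)ᶜ = 0) : μ = atomicMeasure s fun x => μ.real {x} := by
  classical
  ext t ht
  rw [atomicMeasure_apply _ _ ht]
  have h1 : μ t = μ (s.filter (· ∈ t) : Finset ℝ) := by
    rw [← measure_inter_add_sdiff t s.measurableSet,
      measure_mono_null (Set.sdiff_subset_compl t s) hs, add_zero]
    congr 1
    ext x
    simp [and_comm]
  rw [h1, ← sum_measure_singleton, Finset.sum_filter]
  refine Finset.sum_congr rfl fun x _ => ?_
  rw [ofReal_measureReal]
  by_cases hx : x ∈ t <;> simp [hx]

/-! ### Representing measures and moment functionals -/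

section RepMeasure

variable {γ : ℤ → ℝ} {k₁ k₂ : ℕ}

theorem zpow_shift {x : ℝ} (hx : x ≠ 0) (k₁ j : ℕ) :
    x ^ (-2 * (k₁ : ℤ) + j) = x ^ (-2 * (k₁ : ℤ)) * x ^ j := by
  rw [zpow_add₀ hx, zpow_natCast]

theorem zpow_neg_two_mul_pos {x : ℝ} (hx : x ≠ 0) (k₁ : ℕ) : 0 < x ^ (-2 * (k₁ : ℤ)) := by
  have : x ^ (-2 * (k₁ : ℤ)) = (x ^ (2 * k₁))⁻¹ := by
    rw [neg_mul, _root_.zpow_neg]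
    norm_cast
  rw [this]
  exact inv_pos.mpr ((even_two_mul k₁).pow_pos hx)

theorem AtomicMoments.isRepMeasure {s : Finset ℝ} {ρ : ℝ → ℝ}
    (h : AtomicMoments (shift γ k₁) (2 * (k₁ + k₂)) s ρ) (h0 : (0 : ℝ) ∉ s) :
    IsRepMeasure γ k₁ k₂ (atomicMeasure s fun x => ρ x / x ^ (-2 * (k₁ : ℤ))) := by
  have hx0 : ∀ x ∈ s, x ≠ 0 := fun x hx hc => h0 (hc ▸ hx)
  refine ⟨?_, fun i _ _ => integrable_atomicMeasure _ _ _, fun i hi1 hi2 => ?_⟩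
  · rw [atomicMeasure_apply _ _ (measurableSet_singleton 0)]
    refine Finset.sum_eq_zero fun x hx => ?_
    rw [Set.indicator_of_notMem (by simpa using hx0 x hx), mul_zero]
  · rw [integral_atomicMeasure fun x hx => div_pos (h.pos x hx)
      (zpow_neg_two_mul_pos (hx0 x hx) k₁)]
    obtain ⟨j, hj⟩ : ∃ j : ℕ, i = -2 * (k₁ : ℤ) + j := ⟨(i + 2 * k₁).toNat, by omega⟩
    subst hj
    have := h.moment j (by omega)
    rw [shift] at this
    rw [this]
    refine Finset.sum_congr rfl fun x hx => ?_
    have := (zpow_neg_two_mul_pos (hx0 x hx) k₁).ne'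
    rw [zpow_shift (hx0 x hx)]
    field_simp

theorem AtomicMoments.of_isRepMeasure {s : Finset ℝ} {c : ℝ → ℝ} (hc : ∀ x ∈ s, 0 < c x)
    (h : IsRepMeasure γ k₁ k₂ (atomicMeasure s c)) :
    (0 : ℝ) ∉ s ∧
      AtomicMoments (shift γ k₁) (2 * (k₁ + k₂)) s fun x => c x * x ^ (-2 * (k₁ : ℤ)) := by
  have h0 : (0 : ℝ) ∉ s := by
    intro h0
    have h1 := h.supp
    rw [atomicMeasure_apply _ _ (measurableSet_singleton 0)] at h1
    have h2 := Finset.single_le_sum (f := fun x => ENNReal.ofReal (c x) *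
      ({0} : Set ℝ).indicator 1 x) (fun _ _ => zero_le) h0
    rw [h1] at h2
    simp only [Set.mem_singleton_iff, Set.indicator_of_mem, Pi.one_apply, mul_one,
      nonpos_iff_eq_zero, ENNReal.ofReal_eq_zero] at h2
    exact absurd (hc 0 h0) (not_lt.mpr h2)
  have hx0 : ∀ x ∈ s, x ≠ 0 := fun x hx hc => h0 (hc ▸ hx)
  refine ⟨h0, fun x hx => mul_pos (hc x hx) (zpow_neg_two_mul_pos (hx0 x hx) k₁), fun j hj => ?_⟩
  rw [shift, ← h.moment _ (by omega) (by omega), integral_atomicMeasure hc]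
  refine Finset.sum_congr rfl fun x hx => ?_
  rw [zpow_shift (hx0 x hx), mul_assoc]

namespace IsRepMeasure

variable {μ : Measure ℝ}

theorem ae_ne_zero (h : IsRepMeasure γ k₁ k₂ μ) : ∀ᵐ x ∂μ, x ≠ 0 := by
  rw [ae_iff]
  simpa using h.supp

theorem isFiniteMeasure (h : IsRepMeasure γ k₁ k₂ μ) : IsFiniteMeasure μ := by
  have h1 := h.integrable 0 (by omega) (by omega)
  simp only [zpow_zero] at h1
  rwa [integrable_const_iff_isFiniteMeasure one_ne_zero] at h1

theorem integral_eq_mom (h : IsRepMeasure γ k₁ k₂ μ) {f : ℝ[X]}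
    (hf : f.natDegree ≤ 2 * (k₁ + k₂)) :
    Integrable (fun x => x ^ (-2 * (k₁ : ℤ)) * f.eval x) μ ∧
      ∫ x, x ^ (-2 * (k₁ : ℤ)) * f.eval x ∂μ = mom (shift γ k₁) f := by
  -- The law of exponents may fail at 0, so equality holds only almost everywhere, by μ({0}) = 0.
  have hae : (fun x : ℝ => x ^ (-2 * (k₁ : ℤ)) * f.eval x) =ᵐ[μ] fun x =>
      ∑ j ∈ Finset.range (2 * (k₁ + k₂) + 1), f.coeff j * x ^ (-2 * (k₁ : ℤ) + j) := by
    filter_upwards [h.ae_ne_zero] with x hx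
    rw [eval_eq_sum_range' (Nat.lt_succ_of_le hf), Finset.mul_sum]
    refine Finset.sum_congr rfl fun j _ => ?_
    rw [zpow_shift hx]
    ring
  have hint : ∀ j ∈ Finset.range (2 * (k₁ + k₂) + 1),
      Integrable (fun x : ℝ => f.coeff j * x ^ (-2 * (k₁ : ℤ) + j)) μ := by
    intro j hj
    rw [Finset.mem_range] at hj
    exact (h.integrable _ (by omega) (by omega)).const_mul _
  refine ⟨(integrable_congr hae).mpr (integrable_finsetSum _ hint), ?_⟩
  rw [integral_congr_ae hae, integral_finsetSum _ hint,
    mom_eq_sum _ _ _ (Nat.lt_succ_of_le hf)]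
  refine Finset.sum_congr rfl fun j hj => ?_
  rw [Finset.mem_range] at hj
  rw [integral_const_mul, h.moment _ (by omega) (by omega), shift]

theorem mom_sq_nonneg (h : IsRepMeasure γ k₁ k₂ μ) {f : ℝ[X]} (hf : f.natDegree ≤ k₁ + k₂) :
    0 ≤ mom (shift γ k₁) (f * f) := by
  rw [← (h.integral_eq_mom (natDegree_mul_le.trans (by omega))).2]
  refine integral_nonneg_of_ae ?_
  filter_upwards [h.ae_ne_zero] with x hx
  rw [eval_mul]
  exact mul_nonneg (zpow_neg_two_mul_pos hx k₁).le (mul_self_nonneg _)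

theorem ae_eval_eq_zero (h : IsRepMeasure γ k₁ k₂ μ) {f : ℝ[X]} (hf : f.natDegree ≤ k₁ + k₂)
    (h0 : mom (shift γ k₁) (f * f) = 0) : ∀ᵐ x ∂μ, f.eval x = 0 := by
  obtain ⟨hi, he⟩ := h.integral_eq_mom (f := f * f) (natDegree_mul_le.trans (by omega))
  rw [h0, integral_eq_zero_iff_of_nonneg_ae _ hi] at he
  · filter_upwards [he, h.ae_ne_zero] with x hx hx0
    rw [Pi.zero_apply, eval_mul] at hx
    exact mul_self_eq_zero.mp
      ((mul_eq_zero.mp hx).resolve_left (zpow_neg_two_mul_pos hx0 k₁).ne')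
  · filter_upwards [h.ae_ne_zero] with x hx
    rw [eval_mul]
    exact mul_nonneg (zpow_neg_two_mul_pos hx k₁).le (mul_self_nonneg _)

/-- A representing measure annihilating the square of a polynomial lives on its zeros. -/
theorem exists_eq_atomicMeasure (h : IsRepMeasure γ k₁ k₂ μ) {f : ℝ[X]}
    (hf : f.natDegree ≤ k₁ + k₂) (hf0 : f ≠ 0) (h0 : mom (shift γ k₁) (f * f) = 0) :
    ∃ (s : Finset ℝ) (c : ℝ → ℝ), s.card ≤ f.natDegree ∧ (∀ x ∈ s, 0 < c x) ∧
      μ = atomicMeasure s c := by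
  classical
  have := h.isFiniteMeasure
  have hae := h.ae_eval_eq_zero hf h0
  have hroots : μ (f.roots.toFinset : Set ℝ)ᶜ = 0 := by
    rw [ae_iff] at hae
    refine measure_mono_null (fun x hx => ?_) hae
    simpa [hf0] using hx
  have hμ := eq_atomicMeasure μ hroots
  -- Roots without mass are discarded so that all weights are strictly positive.
  refine ⟨f.roots.toFinset.filter fun x => μ.real {x} ≠ 0, fun x => μ.real {x}, ?_, ?_, ?_⟩
  · exact (Finset.card_filter_le _ _).trans
      ((Multiset.toFinset_card_le _).trans (card_roots' f))
  · intro x hx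
    exact lt_of_le_of_ne measureReal_nonneg (Finset.mem_filter.mp hx).2.symm
  · conv_lhs => rw [hμ]
    rw [atomicMeasure, atomicMeasure, Finset.sum_filter]
    refine Finset.sum_congr rfl fun x _ => ?_
    split_ifs with hx
    · rfl
    · rw [not_not.mp hx]
      simp

/-- Uniqueness among all measures, not only atomic ones: L annihilates the square of the node
polynomial, which forces μ onto its zeros. -/
theorem eq_of_atomicMoments (h : IsRepMeasure γ k₁ k₂ μ) {s : Finset ℝ} {ρ : ℝ → ℝ}
    (hat : AtomicMoments (shift γ k₁) (2 * (k₁ + k₂)) s ρ) (hs : s.card ≤ k₁ + k₂) :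
    μ = atomicMeasure s fun x => ρ x / x ^ (-2 * (k₁ : ℤ)) := by
  obtain ⟨s', c, hcard, hc, rfl⟩ := h.exists_eq_atomicMeasure (f := nodePoly s)
    (by rwa [nodePoly_natDegree]) (nodePoly_monic s).ne_zero
    (hat.mom_nodePoly_mul (by rw [nodePoly_natDegree]; omega))
  rw [nodePoly_natDegree] at hcard
  obtain ⟨h0, hat'⟩ := AtomicMoments.of_isRepMeasure hc h
  obtain ⟨rfl, hw⟩ := hat.unique hat' hs (by omega)
  refine atomicMeasure_congr fun x hx => ?_
  have hx0 : x ≠ 0 := fun hc => h0 (hc ▸ hx)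
  rw [← hw x hx, mul_div_cancel_right₀ _ (zpow_neg_two_mul_pos hx0 k₁).ne']

end IsRepMeasure

end RepMeasure

theorem admissible_iff {β : ℤ → ℝ} {k₁ k₂ : ℕ} {x : ℝ} :
    Admissible β k₁ k₂ x ↔ ∃ (s : Finset ℝ) (ρ : ℝ → ℝ), (0 : ℝ) ∉ s ∧
      s.card = (M β (-k₁) (k₂ - 1)).rank ∧
      AtomicMoments (shift (fill β k₂ x) k₁) (2 * (k₁ + k₂)) s ρ := by
  constructor
  · rintro ⟨μ, hμ, s, c, hcard, hc, rfl⟩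
    obtain ⟨h0, hat⟩ := AtomicMoments.of_isRepMeasure hc hμ
    exact ⟨s, _, h0, hcard, hat⟩
  · rintro ⟨s, ρ, h0, hcard, hat⟩
    exact ⟨_, hat.isRepMeasure h0, s, _, hcard, fun x hx =>
      div_pos (hat.pos x hx) (zpow_neg_two_mul_pos (fun hc => h0 (hc ▸ hx)) k₁), rfl⟩

/-! ### Two-sided sequences with a missing moment -/

/-- The position in the shifted sequence of an index `i ≥ -k₁` of the moment matrix. -/
def expo (k₁ : ℕ) {S : Set ℤ} (i : S) : ℕ := ((i : ℤ) + k₁).toNat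

section Missing

variable {β : ℤ → ℝ} {k₁ k₂ m : ℕ}

theorem shift_fill_of_ne (x : ℝ) (hm : k₁ + k₂ = m + 1) {j : ℕ} (hj : j ≠ 2 * m + 1) {i : ℤ}
    (hi : i = -2 * k₁ + j) : shift (fill β k₂ x) k₁ j = β i := by
  rw [shift, fill, Function.update_of_ne (by omega), hi]

theorem shift_fill_missing (x : ℝ) (hm : k₁ + k₂ = m + 1) :
    shift (fill β k₂ x) k₁ (2 * m + 1) = x := by
  rw [shift, fill, show (-2 * (k₁ : ℤ) + ((2 * m + 1 : ℕ) : ℤ)) = 2 * k₂ - 1 by push_cast; omega,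
    Function.update_self]

theorem expo_injective {n₁ n₂ : ℤ} (h : -(k₁ : ℤ) ≤ n₁) :
    Function.Injective (expo k₁ : Set.Icc n₁ n₂ → ℕ) := by
  rintro ⟨i, hi⟩ ⟨j, hj⟩ hij
  rw [Set.mem_Icc] at hi hj
  simp only [expo] at hij
  rw [Subtype.mk.injEq]
  omega

theorem mem_range_expo {n₁ n₂ : ℤ} (h : -(k₁ : ℤ) ≤ n₁) (j : ℕ) :
    j ∈ Set.range (expo k₁ : Set.Icc n₁ n₂ → ℕ) ↔ n₁ + k₁ ≤ j ∧ (j : ℤ) ≤ n₂ + k₁ := by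
  constructor
  · rintro ⟨⟨i, hi⟩, rfl⟩
    rw [Set.mem_Icc] at hi
    simp only [expo]
    omega
  · rintro ⟨h1, h2⟩
    exact ⟨⟨j - k₁, by rw [Set.mem_Icc]; omega⟩, by simp [expo]⟩

theorem range_expo_small (hm : k₁ + k₂ = m + 1) :
    Set.range (expo k₁ : Set.Icc (-(k₁ : ℤ)) (k₂ - 2) → ℕ) = Set.Iio m := by
  ext j
  rw [mem_range_expo le_rfl, Set.mem_Iio]
  omega

theorem range_expo_large (hm : k₁ + k₂ = m + 1) :
    Set.range (expo k₁ : Set.Icc (-(k₁ : ℤ)) (k₂ - 1) → ℕ) = Set.Iio (m + 1) := by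
  ext j
  rw [mem_range_expo le_rfl, Set.mem_Iio]
  omega

theorem elim_expo_injective (hm : k₁ + k₂ = m + 1) {n₁ n₂ : ℤ} (h : -(k₁ : ℤ) ≤ n₁) {d : ℕ}
    (hd : n₂ + k₁ < d) :
    Function.Injective (Sum.elim (expo k₁ : Set.Icc n₁ n₂ → ℕ) fun _ : Unit => d) := by
  refine Function.Injective.sumElim (expo_injective h) (fun _ _ _ => rfl) fun i _ hi => ?_
  have := (mem_range_expo h d).mp ⟨i, hi⟩
  omega

theorem mem_range_elim_expo {n₁ n₂ : ℤ} (h : -(k₁ : ℤ) ≤ n₁) (d j : ℕ) :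
    j ∈ Set.range (Sum.elim (expo k₁ : Set.Icc n₁ n₂ → ℕ) fun _ : Unit => d) ↔
      (n₁ + k₁ ≤ j ∧ (j : ℤ) ≤ n₂ + k₁) ∨ j = d := by
  rw [Set.Sum.elim_range, Set.mem_union, mem_range_expo h]
  simp [eq_comm]

/-- The bound on n₂ keeps all index sums at most 2k₂ - 2, below the missing moment, so any x may be
filled in. -/
theorem M_eq_gram (x : ℝ) (hm : k₁ + k₂ = m + 1) {n₁ n₂ : ℤ} (h : -(k₁ : ℤ) ≤ n₁)
    (h' : n₂ ≤ k₂ - 1) : M β n₁ n₂ = gram (shift (fill β k₂ x) k₁) (expo k₁) := by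
  ext ⟨i, hi⟩ ⟨j, hj⟩
  rw [Set.mem_Icc] at hi hj
  simp only [M, gram, of_apply, expo]
  rw [shift_fill_of_ne x hm (by omega) (i := i + j) (by push_cast; omega)]

theorem bordered_gram {n : Type} (a : ℕ → ℝ) (e : n → ℕ) (d : ℕ) :
    bordered (gram a e) (fun i => a (e i + d)) (a (2 * d))
      = gram a (Sum.elim e fun _ : Unit => d) := by
  ext i j
  rcases i with i | i <;> rcases j with j | j <;>
    simp [bordered, gram, fromBlocks, add_comm, two_mul]

theorem vec_eq (x : ℝ) (hm : k₁ + k₂ = m + 1) {n₁ : ℤ} (h : -(k₁ : ℤ) ≤ n₁) :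
    (fun i : Set.Icc n₁ ((k₂ : ℤ) - 2) => β (k₂ + i))
      = fun i => shift (fill β k₂ x) k₁ (expo k₁ i + (m + 1)) := by
  funext ⟨i, hi⟩
  rw [Set.mem_Icc] at hi
  simp only [expo]
  rw [shift_fill_of_ne x hm (by omega) (i := k₂ + i) (by push_cast; omega)]

theorem wVec_eq (x : ℝ) (hm : k₁ + k₂ = m + 1) :
    wVec β k₁ k₂ = fun i => shift (fill β k₂ x) k₁ (expo k₁ i + m) := by
  funext ⟨i, hi⟩
  rw [Set.mem_Icc] at hi
  simp only [wVec, expo]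
  rw [shift_fill_of_ne x hm (by omega) (i := k₂ - 1 + i) (by push_cast; omega)]

theorem ATilde_eq (x : ℝ) (hm : k₁ + k₂ = m + 1) :
    ATilde β k₁ k₂ = gram (shift (fill β k₂ x) k₁)
      (Sum.elim (expo k₁ : Set.Icc (-(k₁ : ℤ) + 1) (k₂ - 2) → ℕ) fun _ => m + 1) := by
  rw [← bordered_gram, ← vec_eq x hm (by omega), ← M_eq_gram x hm (by omega) (by omega),
    shift_fill_of_ne x hm (by omega) (i := 2 * k₂) (by push_cast; omega)]
  rfl

theorem AHat_eq (x : ℝ) (hm : k₁ + k₂ = m + 1) :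
    AHat β k₁ k₂ = gram (shift (fill β k₂ x) k₁)
      (Sum.elim (expo k₁ : Set.Icc (-(k₁ : ℤ)) (k₂ - 2) → ℕ) fun _ => m + 1) := by
  rw [← bordered_gram, ← vec_eq x hm (by omega), ← M_eq_gram x hm (by omega) (by omega),
    shift_fill_of_ne x hm (by omega) (i := 2 * k₂) (by push_cast; omega)]
  rfl

theorem CMat_eq (x : ℝ) (hm : k₁ + k₂ = m + 1) :
    CMat β k₁ k₂ = gram (fun j => shift (fill β k₂ x) k₁ (j + 1)) (expo k₁) := by
  ext ⟨i, hi⟩ ⟨j, hj⟩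
  rw [Set.mem_Icc] at hi hj
  simp only [CMat, gram, of_apply, expo]
  rw [shift_fill_of_ne x hm (by omega) (i := i + j + 1) (by push_cast; omega)]

theorem schurCompl_bordered {n : Type} [Fintype n] (A : Matrix n n ℝ) (b : n → ℝ) (c : ℝ) :
    schurCompl (bordered A b c) () () = c - b ⬝ᵥ (pinv A *ᵥ b) := by
  simp only [schurCompl, bordered, toBlocks_fromBlocks₁₁, toBlocks_fromBlocks₁₂,
    toBlocks_fromBlocks₂₁, toBlocks_fromBlocks₂₂, Matrix.sub_apply]
  rw [Matrix.mul_assoc]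
  rfl

theorem posDef_M_iff (x : ℝ) (hm : k₁ + k₂ = m + 1) :
    (M β (-k₁) (k₂ - 1)).PosDef ↔ ∀ f : ℝ[X], f.degree < (m + 1 : ℕ) → f ≠ 0 →
      0 < mom (shift (fill β k₂ x) k₁) (f * f) := by
  rw [M_eq_gram x hm le_rfl le_rfl]
  exact gram_posDef_iff_degree _ (expo_injective le_rfl) (range_expo_large hm)

theorem posDef_ATilde_iff (x : ℝ) (hm : k₁ + k₂ = m + 1) :
    (ATilde β k₁ k₂).PosDef ↔ ∀ f : ℝ[X], f.natDegree ≤ m + 1 → f.coeff 0 = 0 → f.coeff m = 0 →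
      f ≠ 0 → 0 < mom (shift (fill β k₂ x) k₁) (f * f) := by
  rw [ATilde_eq x hm, gram_posDef_iff _ (elim_expo_injective hm (by omega) (by push_cast; omega))]
  refine forall_congr' fun f => ?_
  simp only [mem_range_elim_expo (show -(k₁ : ℤ) ≤ -(k₁ : ℤ) + 1 by omega)]
  constructor
  · intro h hd h0 hm0
    refine h fun j hj => ?_
    rcases Nat.lt_or_ge (m + 1) j with hj' | hj'
    · exact coeff_eq_zero_of_natDegree_lt (by omega)
    · obtain rfl | rfl : j = 0 ∨ j = m := by omega
      · exact h0
      · exact hm0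
  · intro h hc
    exact h (natDegree_le_iff_coeff_eq_zero.mpr fun j hj => hc j (by omega)) (hc 0 (by omega))
      (hc m (by omega))

/-- The only index pair summing to 2k₂ - 1 is {k₂ - 1, k₂}, so the maximal fully specified principal
submatrices are obtained by dropping k₂ or k₂ - 1, that is, X^(m+1) or X^m. -/
theorem isPartiallyPSD_iff (x : ℝ) (hm : k₁ + k₂ = m + 1) :
    IsPartiallyPSD (partialM β k₁ k₂) ↔
      (∀ f : ℝ[X], f.degree < (m + 1 : ℕ) → 0 ≤ mom (shift (fill β k₂ x) k₁) (f * f)) ∧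
      ∀ f : ℝ[X], f.natDegree ≤ m + 1 → f.coeff m = 0 →
        0 ≤ mom (shift (fill β k₂ x) k₁) (f * f) := by
  classical
  have hinj : ∀ S : Set (Set.Icc (-(k₁ : ℤ)) (k₂ : ℤ)),
      Function.Injective fun i : S => expo k₁ i.1 := fun S =>
    (expo_injective le_rfl).comp Subtype.val_injective
  have hrange : ∀ (S : Set (Set.Icc (-(k₁ : ℤ)) (k₂ : ℤ))) (j : ℕ),
      j ∈ Set.range (fun i : S => expo k₁ i.1) ↔ ∃ h : (j : ℤ) - k₁ ∈ Set.Icc (-(k₁ : ℤ)) (k₂ : ℤ),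
        (⟨(j : ℤ) - k₁, h⟩ : Set.Icc (-(k₁ : ℤ)) (k₂ : ℤ)) ∈ S := by
    intro S j
    constructor
    · rintro ⟨⟨⟨i, hi⟩, hiS⟩, rfl⟩
      have : (((i + k₁).toNat : ℕ) : ℤ) - k₁ = i := by
        rw [Set.mem_Icc] at hi
        omega
      simp only [expo, this]
      exact ⟨hi, hiS⟩
    · rintro ⟨h, hS⟩
      exact ⟨⟨_, hS⟩, by simp [expo]⟩
  have hentry : ∀ (i j : Set.Icc (-(k₁ : ℤ)) (k₂ : ℤ)), (i : ℤ) + j ≠ 2 * k₂ - 1 →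
      β (i + j) = shift (fill β k₂ x) k₁ (expo k₁ i + expo k₁ j) := by
    rintro ⟨i, hi⟩ ⟨j, hj⟩ hij
    rw [Set.mem_Icc] at hi hj
    simp only [expo] at hij ⊢
    rw [shift_fill_of_ne x hm (by omega) (i := i + j) (by push_cast; omega)]
  have hspec : ∀ S : Set (Set.Icc (-(k₁ : ℤ)) (k₂ : ℤ)),
      (∀ i j : S, (i.1 : ℤ) + j.1 ≠ 2 * k₂ - 1) → IsPartiallyPSD (partialM β k₁ k₂) →
      ∀ f : ℝ[X], (∀ j, j ∉ Set.range (fun i : S => expo k₁ i.1) → f.coeff j = 0) →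
        0 ≤ mom (shift (fill β k₂ x) k₁) (f * f) := by
    intro S hS h
    have := Fintype.ofFinite S
    rw [← gram_posSemidef_iff _ (hinj S)]
    refine h.2 S _ fun i j => ?_
    rw [partialM, of_apply, if_neg (hS i j), hentry _ _ (hS i j)]
    rfl
  constructor
  · intro h
    constructor
    · intro f hf
      rw [degree_lt_iff_coeff_zero] at hf
      refine hspec {i | (i : ℤ) ≠ k₂} ?_ h f fun j hj => hf j ?_
      · rintro ⟨⟨i, hi⟩, hi'⟩ ⟨⟨j, hj⟩, hj'⟩
        rw [Set.mem_Icc] at hi hj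
        simp only [Set.mem_ofPred_eq] at hi' hj' ⊢
        omega
      · rw [hrange] at hj
        by_contra hc
        exact hj ⟨by rw [Set.mem_Icc]; omega, by simp only [Set.mem_ofPred_eq]; omega⟩
    · intro f hf hfm
      refine hspec {i | (i : ℤ) ≠ k₂ - 1} ?_ h f fun j hj => ?_
      · rintro ⟨⟨i, hi⟩, hi'⟩ ⟨⟨j, hj⟩, hj'⟩
        rw [Set.mem_Icc] at hi hj
        simp only [Set.mem_ofPred_eq] at hi' hj' ⊢
        omega
      · rw [hrange] at hj
        rcases Nat.lt_or_ge (m + 1) j with hj' | hj'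
        · exact coeff_eq_zero_of_natDegree_lt (by omega)
        · by_cases hjm : j = m
          · rw [hjm, hfm]
          · exact absurd ⟨by rw [Set.mem_Icc]; omega, by simp only [Set.mem_ofPred_eq]; omega⟩ hj
  · rintro ⟨h1, h2⟩
    refine ⟨fun i j => by simp only [partialM, of_apply, add_comm], fun S B hB => ?_⟩
    have := Fintype.ofFinite S
    have hne : ∀ i j : S, (i.1 : ℤ) + j.1 ≠ 2 * k₂ - 1 := by
      intro i j hij
      have := hB i j
      rw [partialM, of_apply, if_pos hij] at this
      exact Option.some_ne_none _ this.symm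
    have hBg : B = gram (shift (fill β k₂ x) k₁) fun i : S => expo k₁ i.1 := by
      ext i j
      have := hB i j
      rw [partialM, of_apply, if_neg (hne i j), Option.some.injEq] at this
      rw [← this, hentry _ _ (hne i j)]
      rfl
    rw [hBg, gram_posSemidef_iff _ (hinj S)]
    intro f hf
    have hbig : ∀ j, m + 1 < j → f.coeff j = 0 := fun j hj => hf j (by
      rw [hrange]
      rintro ⟨h, -⟩
      rw [Set.mem_Icc] at h
      omega)
    by_cases htop : m + 1 ∈ Set.range fun i : S => expo k₁ i.1
    · refine h2 f (natDegree_le_iff_coeff_eq_zero.mpr hbig) (hf m ?_)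
      intro hmem
      rw [hrange] at htop hmem
      obtain ⟨p1, p2⟩ := htop
      obtain ⟨q1, q2⟩ := hmem
      refine hne ⟨_, p2⟩ ⟨_, q2⟩ ?_
      push_cast
      omega
    · refine h1 f ((degree_lt_iff_coeff_zero _ _).mpr fun j hj => ?_)
      rcases hj.eq_or_lt with rfl | hj'
      · exact hf _ htop
      · exact hbig j hj'

theorem exists_isSchurPair_fill (x : ℝ) (hm : k₁ + k₂ = m + 1)
    (h : IsPartiallyPSD (partialM β k₁ k₂)) :
    ∃ P Q : ℝ[X], IsSchurPair (shift (fill β k₂ x) k₁) m (sVal β k₁ k₂) (tVal β k₁ k₂)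
      (x - center β k₁ k₂) P Q := by
  obtain ⟨h1, h2⟩ := (isPartiallyPSD_iff x hm).mp h
  have hu : uVec β k₁ k₂ = fun i => shift (fill β k₂ x) k₁ (expo k₁ i + (m + 1)) :=
    vec_eq x hm le_rfl
  have hs : sVal β k₁ k₂ = _ := schurCompl_bordered _ _ _
  have ht : tVal β k₁ k₂ = _ := schurCompl_bordered _ _ _
  rw [hs, ht, center, hu, wVec_eq x hm, M_eq_gram x hm le_rfl (by omega)]
  have := exists_isSchurPair (range_expo_small hm) h1 h2
  rwa [shift_fill_missing x hm, shift_fill_of_ne x hm (by omega) (i := 2 * k₂ - 2) (by omega),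
    shift_fill_of_ne x hm (by omega) (i := 2 * k₂) (by omega)] at this

theorem coeff_zero_iff_isExceptional (x : ℝ) (hm : k₁ + k₂ = m + 1)
    (hpd : (M β (-k₁) (k₂ - 1)).PosDef) {p : ℝ[X]} (hp : p.Monic) (hpm : p.natDegree = m + 1)
    (hpo : ∀ i < m + 1, mom (shift (fill β k₂ x) k₁) (p * X ^ i) = 0) :
    p.coeff 0 = 0 ↔ IsExceptional β k₁ k₂ x := by
  have hu : uVec β k₁ k₂ = fun i => shift (fill β k₂ x) k₁ (expo k₁ i + (m + 1)) :=
    vec_eq x hm le_rfl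
  have := coeff_zero_eq_zero_iff (expo_injective le_rfl) (range_expo_small hm)
    ((posDef_M_iff x hm).mp hpd) hp hpm hpo
  rw [shift_fill_missing x hm] at this
  rw [this, IsExceptional, CMat_eq x hm, hu]

/-! ### Admissible values -/

theorem rank_M_eq_card {x : ℝ} (hm : k₁ + k₂ = m + 1) {s : Finset ℝ} {ρ : ℝ → ℝ}
    (hat : AtomicMoments (shift (fill β k₂ x) k₁) (2 * (m + 1)) s ρ) (hs : s.card ≤ m + 1) :
    (M β (-k₁) (k₂ - 1)).rank = s.card := by
  have hlt : ∀ i : Set.Icc (-(k₁ : ℤ)) ((k₂ : ℤ) - 1), expo k₁ i < m + 1 := fun i => by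
    have : expo k₁ i ∈ Set.range (expo k₁ : Set.Icc (-(k₁ : ℤ)) (k₂ - 1) → ℕ) := ⟨i, rfl⟩
    rwa [range_expo_large hm] at this
  rw [M_eq_gram x hm le_rfl le_rfl]
  refine rank_gram_eq_card hat.pos (fun i j => hat.moment _ ?_) (expo_injective le_rfl) 0
    (by simp) fun i hi => ?_
  · have := hlt i
    have := hlt j
    omega
  · rw [range_expo_large hm, Set.mem_Iio]
    omega

/-- The number of atoms need not be prescribed: at most m + 1 nodes are separated by the m + 1
monomials of M(-k₁, k₂-1), whose rank therefore counts them. -/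
theorem admissible_iff_exists (hm : k₁ + k₂ = m + 1) {x : ℝ} :
    Admissible β k₁ k₂ x ↔ ∃ (s : Finset ℝ) (ρ : ℝ → ℝ), (0 : ℝ) ∉ s ∧ s.card ≤ m + 1 ∧
      AtomicMoments (shift (fill β k₂ x) k₁) (2 * (m + 1)) s ρ := by
  rw [admissible_iff, hm]
  constructor
  · rintro ⟨s, ρ, h0, hcard, hat⟩
    refine ⟨s, ρ, h0, ?_, hat⟩
    rw [hcard]
    refine (rank_le_card_width _).trans ?_
    simp only [Fintype.card_ofFinset, Int.card_Icc]
    simp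
    omega
  · rintro ⟨s, ρ, h0, hcard, hat⟩
    exact ⟨s, ρ, h0, (rank_M_eq_card hm hat hcard).symm, hat⟩

/-- Since s > 0, the singular 2 × 2 Gram matrix has kernel vector (-δ/s, 1). Definiteness below
degree m + 1 then fixes both the number of atoms and the node polynomial. -/
theorem exists_atomicMoments_of_sq_eq {x : ℝ} (hm : k₁ + k₂ = m + 1)
    (hpd : (M β (-k₁) (k₂ - 1)).PosDef) {s t δ : ℝ} {P Q : ℝ[X]}
    (h : IsSchurPair (shift (fill β k₂ x) k₁) m s t δ P Q) (hδ : δ ^ 2 = s * t) :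
    0 < s ∧ ∃ (S : Finset ℝ) (ρ : ℝ → ℝ), S.card = m + 1 ∧
      AtomicMoments (shift (fill β k₂ x) k₁) (2 * (m + 1)) S ρ ∧
      nodePoly S = Q - C (δ / s) * P := by
  rw [posDef_M_iff x hm] at hpd
  have hs : 0 < s := by
    rw [← h.left_left]
    refine hpd P ?_ h.left_ne_zero
    rw [← natDegree_lt_iff_degree_lt h.left_ne_zero]
    exact Nat.lt_succ_of_le h.natDegree_left
  have hpsd : ∀ g : ℝ[X], g.degree < m → 0 ≤ mom (shift (fill β k₂ x) k₁) (g * g) := by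
    intro g hg
    by_cases hg0 : g = 0
    · simp [hg0]
    · exact (hpd g (hg.trans (by exact_mod_cast Nat.lt_succ_self m)) hg0).le
  have h1 : δ / s * s = δ := div_mul_cancel₀ _ hs.ne'
  have h2 : δ / s * δ = t := by
    rw [div_mul_eq_mul_div, ← sq, hδ, mul_div_cancel_left₀ _ hs.ne']
  obtain ⟨S, ρ, hS, hat⟩ := h.exists_atomicMoments hpsd hs.le h1 h2
  have hcard := hat.card_eq hpd hS
  refine ⟨hs, S, ρ, hcard, hat, ?_⟩
  refine eq_of_monic_orthogonal hpd (nodePoly_monic S) (h.comb_natDegree _).2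
    (by rw [nodePoly_natDegree, hcard]) (h.comb_natDegree _).1 (fun i hi => ?_) fun i hi => ?_
  · exact hat.mom_nodePoly_mul (by rw [natDegree_X_pow]; omega)
  · exact h.comb_mul_eq_zero h1 h2 (by rw [natDegree_X_pow]; omega)

theorem zero_mem_iff_isExceptional {x : ℝ} (hm : k₁ + k₂ = m + 1)
    (hpd : (M β (-k₁) (k₂ - 1)).PosDef) {S : Finset ℝ} {ρ : ℝ → ℝ}
    (hat : AtomicMoments (shift (fill β k₂ x) k₁) (2 * (m + 1)) S ρ) (hS : S.card = m + 1) :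
    (0 : ℝ) ∈ S ↔ IsExceptional β k₁ k₂ x := by
  rw [← nodePoly_eval_eq_zero, ← coeff_zero_eq_eval_zero]
  exact coeff_zero_iff_isExceptional x hm hpd (nodePoly_monic S) (by rw [nodePoly_natDegree, hS])
    fun i hi => hat.mom_nodePoly_mul (by rw [natDegree_X_pow]; omega)

theorem admissible_iff_of_posDef {x : ℝ} (hm : k₁ + k₂ = m + 1)
    (hpd : (M β (-k₁) (k₂ - 1)).PosDef) (hpsd : IsPartiallyPSD (partialM β k₁ k₂)) :
    Admissible β k₁ k₂ x ↔ (x - center β k₁ k₂) ^ 2 = sVal β k₁ k₂ * tVal β k₁ k₂ ∧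
      ¬ IsExceptional β k₁ k₂ x := by
  obtain ⟨P, Q, h⟩ := exists_isSchurPair_fill x hm hpsd
  rw [admissible_iff_exists hm]
  constructor
  · rintro ⟨S, ρ, h0, hcard, hat⟩
    have hS := hat.card_eq ((posDef_M_iff x hm).mp hpd) hcard
    refine ⟨?_, fun hex => h0 ((zero_mem_iff_isExceptional hm hpd hat hS).mpr hex)⟩
    obtain ⟨g, hg, hdec⟩ := h.exists_decomp (f := nodePoly S) (by rw [nodePoly_natDegree, hS])
    have hPd := h.natDegree_left
    have hQd : Q.natDegree ≤ m + 1 := by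
      have := (h.comb_natDegree 0).1
      rw [C_0, zero_mul, sub_zero] at this
      exact this.le
    have htop : (nodePoly S).coeff (m + 1) = 1 := by
      have := nodePoly_monic S
      rwa [Monic, leadingCoeff, nodePoly_natDegree, hS] at this
    have hP : mom (shift (fill β k₂ x) k₁) (nodePoly S * P) = 0 :=
      hat.mom_nodePoly_mul (by omega)
    have hQ : mom (shift (fill β k₂ x) k₁) (nodePoly S * Q) = 0 :=
      hat.mom_nodePoly_mul (by omega)
    rw [htop] at hdec
    generalize (nodePoly S).coeff m = α at hdec
    rw [hdec] at hP hQ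
    have e1 : (g + C α * P + C 1 * Q) * P = P * g + C α * (P * P) + P * Q := by
      rw [C_1]; ring
    have e2 : (g + C α * P + C 1 * Q) * Q = Q * g + C α * (P * Q) + Q * Q := by
      rw [C_1]; ring
    rw [e1, map_add, map_add, mom_C_mul, h.orth_left g hg, h.left_left, h.left_right] at hP
    rw [e2, map_add, map_add, mom_C_mul, h.orth_right g hg, h.right_right, h.left_right] at hQ
    -- With δ = x - c, orthogonality of the node polynomial to P and Q reads αs + δ = 0 and αδ + t =
    -- 0; eliminating α leaves δ² = st.
    linear_combination (x - center β k₁ k₂) * hP - sVal β k₁ k₂ * hQ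
  · rintro ⟨hδ, hex⟩
    obtain ⟨-, S, ρ, hS, hat, -⟩ := exists_atomicMoments_of_sq_eq hm hpd h hδ
    exact ⟨S, ρ, fun h0 => hex ((zero_mem_iff_isExceptional hm hpd hat hS).mp h0), hS.le, hat⟩

theorem exists_admissible_of_posDef (hm : k₁ + k₂ = m + 1)
    (hpsd : IsPartiallyPSD (partialM β k₁ k₂)) (hpd : (M β (-k₁) (k₂ - 1)).PosDef)
    (hA : (ATilde β k₁ k₂).PosDef) : ∃ x, Admissible β k₁ k₂ x := by
  obtain ⟨P, Q, h⟩ := exists_isSchurPair_fill (center β k₁ k₂) hm hpsd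
  rw [sub_self] at h
  have ht : 0 ≤ tVal β k₁ k₂ := by
    rw [← h.right_right]
    refine ((isPartiallyPSD_iff _ hm).mp hpsd).2 Q ?_ ?_
    · have := (h.comb_natDegree 0).1
      rw [C_0, zero_mul, sub_zero] at this
      exact this.le
    · rw [h.coeff_right le_rfl, if_neg (by omega)]
  have hs : 0 < sVal β k₁ k₂ := by
    rw [← h.left_left]
    refine (posDef_M_iff _ hm).mp hpd P ?_ h.left_ne_zero
    rw [← natDegree_lt_iff_degree_lt h.left_ne_zero]
    exact Nat.lt_succ_of_le h.natDegree_left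
  rcases ht.eq_or_lt with ht0 | ht0
  -- For t = 0 the node polynomial at the center is Q, which has no X^m term. If Q(0) = 0, then Ã ≻
  -- 0 applies to Q and contradicts L(Q²) = t = 0.
  · obtain ⟨-, S, ρ, hS, hat, hnode⟩ := exists_atomicMoments_of_sq_eq hm hpd h (by simp [← ht0])
    rw [zero_div, C_0, zero_mul, sub_zero] at hnode
    refine ⟨_, (admissible_iff_exists hm).mpr ⟨S, ρ, fun h0 => ?_, hS.le, hat⟩⟩
    rw [← nodePoly_eval_eq_zero, ← coeff_zero_eq_eval_zero, hnode] at h0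
    have := (posDef_ATilde_iff (center β k₁ k₂) hm).mp hA Q
      (by rw [← hnode, nodePoly_natDegree, hS]) h0
      (by rw [h.coeff_right le_rfl, if_neg (by omega)]) (hnode ▸ (nodePoly_monic S).ne_zero)
    rw [h.right_right, ← ht0] at this
    exact lt_irrefl _ this
  · have hpos : 0 < √(sVal β k₁ k₂ * tVal β k₁ k₂) := Real.sqrt_pos.mpr (mul_pos hs ht0)
    have hsq := Real.sq_sqrt (mul_pos hs ht0).le
    -- The two candidates differ and the exceptional value is unique, so at least one survives.
    by_cases hex : IsExceptional β k₁ k₂ (center β k₁ k₂ + √(sVal β k₁ k₂ * tVal β k₁ k₂))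
    · refine ⟨center β k₁ k₂ - √(sVal β k₁ k₂ * tVal β k₁ k₂),
        (admissible_iff_of_posDef hm hpd hpsd).mpr ⟨by linear_combination hsq, fun hex' => ?_⟩⟩
      have := hex.2.trans hex'.2.symm
      linarith
    · exact ⟨_, (admissible_iff_of_posDef hm hpd hpsd).mpr ⟨by linear_combination hsq, hex⟩⟩

end Missing

/-- If bordering by the exponent `d` keeps the rank of a Gram matrix, then the orthogonal
projection of `X ^ d` is isotropic. -/
theorem mom_sq_eq_zero_of_rank_eq {n : Type} [Fintype n] {e : n → ℕ} {a : ℕ → ℝ} {d r : ℕ}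
    {R : ℝ[X]} (hr : Set.range e = Set.Iio r) (hR : (X ^ d - R).degree < (r : WithBot ℕ))
    (horth : ∀ g : ℝ[X], g.degree < r → mom a (R * g) = 0)
    (hrank : (gram a (Sum.elim e fun _ : Unit => d)).rank = (gram a e).rank) :
    mom a (R * R) = 0 := by
  obtain ⟨v, hv⟩ := exists_mulVec_eq_zero_of_rank_eq
    (B := gram a (Sum.elim e fun _ : Unit => d)) hrank
  have hlt : ∀ i, e i < r := fun i => by
    have : e i ∈ Set.range e := ⟨i, rfl⟩
    rwa [hr] at this
  set f := expPoly (Sum.elim e fun _ : Unit => d) (Sum.elim v fun _ => 1) with hf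
  have hpoly : f = expPoly e v + X ^ d := by
    simp [hf, expPoly]
  have hff : mom a (f * f) = 0 := by
    rw [hf, ← gram_dotProduct, hv, dotProduct_zero]
  have hfg : ∀ g : ℝ[X], g.degree < r → mom a (f * g) = 0 := by
    intro g hg
    refine mom_mul_eq_zero (fun i hi => ?_) hg
    have : i ∈ Set.range e := by rw [hr]; exact hi
    obtain ⟨i, rfl⟩ := this
    have h1 := congrFun hv (Sum.inl i)
    rw [gram_mulVec] at h1
    rw [mul_comm]
    exact h1
  have hdiff : (R - f).degree < (r : WithBot ℕ) := by
    have : R - f = -((X ^ d - R) + expPoly e v) := by rw [hpoly]; ring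
    rw [this, degree_neg]
    exact (degree_add_le _ _).trans_lt (max_lt hR (expPoly_degree_lt hlt v))
  -- R - f has degree less than r, and both R and f are orthogonal to such polynomials.
  have e1 : R * R = R * (R - f) + f * (R - f) + f * f := by ring
  rw [e1, map_add, map_add, horth _ hdiff, hfg _ hdiff, hff]
  simp

/-! ### Matrix and recursion criteria for admissibility -/

section Missing

variable {β : ℤ → ℝ} {k₁ k₂ m : ℕ}

theorem exists_admissible_of_rank_eq (hm : k₁ + k₂ = m + 1)
    (hpsd : IsPartiallyPSD (partialM β k₁ k₂))
    (h1 : (M β (-k₁ + 1) (k₂ - 1)).rank = (M β (-k₁) (k₂ - 1)).rank)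
    (h2 : (M β (-k₁) (k₂ - 1)).rank = (M β (-k₁) (k₂ - 2)).rank)
    (h3 : (M β (-k₁) (k₂ - 2)).rank = (AHat β k₁ k₂).rank) : ∃ x, Admissible β k₁ k₂ x := by
  classical
  obtain ⟨P, Q, h⟩ := exists_isSchurPair_fill (center β k₁ k₂) hm hpsd
  rw [sub_self] at h
  have hsmall := range_expo_small (k₁ := k₁) (k₂ := k₂) hm
  rw [M_eq_gram (center β k₁ k₂) hm le_rfl (by omega), AHat_eq (center β k₁ k₂) hm] at h3
  have ht : tVal β k₁ k₂ = 0 := by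
    rw [← h.right_right]
    exact mom_sq_eq_zero_of_rank_eq hsmall h.sub_right h.orth_right h3.symm
  have hs : sVal β k₁ k₂ = 0 := by
    rw [← h.left_left]
    refine mom_sq_eq_zero_of_rank_eq hsmall h.sub_left h.orth_left ?_
    rw [M_eq_gram (center β k₁ k₂) hm le_rfl le_rfl,
      M_eq_gram (center β k₁ k₂) hm le_rfl (by omega)] at h2
    rw [← h2]
    refine rank_gram_congr _ (elim_expo_injective hm le_rfl (by omega)) (expo_injective le_rfl) ?_
    ext j
    rw [mem_range_elim_expo le_rfl, mem_range_expo le_rfl]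
    omega
  obtain ⟨S, ρ, hS, hat⟩ := h.exists_atomicMoments (c := 0)
    (fun g hg => ((isPartiallyPSD_iff _ hm).mp hpsd).1 g
      (hg.trans (by exact_mod_cast Nat.lt_succ_self m)))
    hs.ge (by simp) (by simp [ht])
  refine ⟨_, (admissible_iff_exists hm).mpr ⟨S, ρ, fun h0 => ?_, hS, hat⟩⟩
  rw [rank_M_eq_card hm hat hS, M_eq_gram (center β k₁ k₂) hm (by omega) le_rfl] at h1
  have hpos : ∀ i : Set.Icc (-(k₁ : ℤ) + 1) ((k₂ : ℤ) - 1), 0 < expo k₁ i ∧ expo k₁ i ≤ m := by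
    intro i
    have := (mem_range_expo (show -(k₁ : ℤ) ≤ -(k₁ : ℤ) + 1 by omega) (expo k₁ i)).mp ⟨i, rfl⟩
    omega
  -- Only positive exponents occur in M(-k₁+1, k₂-1), so an atom at 0 contributes nothing and the
  -- rank would be at most |S| - 1.
  have hle := rank_gram_le_card (e := (expo k₁ : Set.Icc (-(k₁ : ℤ) + 1) ((k₂ : ℤ) - 1) → ℕ))
    (a := shift (fill β k₂ (center β k₁ k₂)) k₁) (s := S.erase 0) (ρ := ρ)
    (fun x hx => hat.pos x (Finset.mem_of_mem_erase hx)) fun i j => by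
      have := hpos i
      have := hpos j
      rw [hat.moment _ (by omega), ← Finset.sum_erase_add _ _ h0, zero_pow (by omega), mul_zero,
        add_zero]
  rw [h1, Finset.card_erase_of_mem h0] at hle
  have := Finset.card_pos.mpr ⟨0, h0⟩
  omega

/-- Each index set contains m consecutive exponents, enough to separate |S| ≤ m nodes; for exponents
starting at 1 this needs 0 ∉ S. -/
theorem rank_conditions_of_atomicMoments {x : ℝ} (hm : k₁ + k₂ = m + 1) {S : Finset ℝ}
    {ρ : ℝ → ℝ} (hat : AtomicMoments (shift (fill β k₂ x) k₁) (2 * (m + 1)) S ρ)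
    (h0 : (0 : ℝ) ∉ S) (hS : S.card ≤ m) :
    (M β (-k₁ + 1) (k₂ - 1)).rank = S.card ∧ (M β (-k₁) (k₂ - 1)).rank = S.card ∧
      (M β (-k₁) (k₂ - 2)).rank = S.card ∧ (AHat β k₁ k₂).rank = S.card := by
  have key : ∀ {n : Type} [Fintype n] {e : n → ℕ}, e.Injective → (∀ i ∈ Set.range e, i ≤ m + 1) →
      (∃ l, ∀ i < m, l + i ∈ Set.range e) →
      (gram (shift (fill β k₂ x) k₁) e).rank = S.card := by
    intro n _ e he hle hl
    obtain ⟨l, hl⟩ := hl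
    refine rank_gram_eq_card hat.pos (fun i j => hat.moment _ ?_) he l
      (fun y hy => pow_ne_zero _ fun hc => h0 (hc ▸ hy)) fun i hi => hl i (by omega)
    have := hle _ ⟨i, rfl⟩
    have := hle _ ⟨j, rfl⟩
    omega
  refine ⟨?_, rank_M_eq_card hm hat (by omega), ?_, ?_⟩
  · rw [M_eq_gram x hm (by omega) le_rfl]
    have hr := mem_range_expo (k₁ := k₁) (n₂ := (k₂ : ℤ) - 1)
      (show -(k₁ : ℤ) ≤ -(k₁ : ℤ) + 1 by omega)
    refine key (expo_injective (by omega)) (fun i hi => ?_) ⟨1, fun i hi => ?_⟩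
    · rw [hr] at hi
      omega
    · rw [hr]
      push_cast
      omega
  · rw [M_eq_gram x hm le_rfl (by omega)]
    refine key (expo_injective le_rfl) (fun i hi => ?_) ⟨0, fun i hi => ?_⟩
    · rw [range_expo_small hm, Set.mem_Iio] at hi
      omega
    · rw [range_expo_small hm, Set.mem_Iio]
      omega
  · rw [AHat_eq x hm]
    refine key (elim_expo_injective hm le_rfl (by push_cast; omega)) (fun i hi => ?_)
      ⟨0, fun i hi => ?_⟩
    · rw [mem_range_elim_expo le_rfl] at hi
      omega
    · rw [mem_range_elim_expo le_rfl]
      push_cast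
      omega

theorem isPartiallyPSD_of_nonneg {x : ℝ} (hm : k₁ + k₂ = m + 1)
    (h : ∀ f : ℝ[X], f.natDegree ≤ m + 1 → 0 ≤ mom (shift (fill β k₂ x) k₁) (f * f)) :
    IsPartiallyPSD (partialM β k₁ k₂) :=
  (isPartiallyPSD_iff x hm).mpr ⟨fun f hf => h f (natDegree_le_iff_coeff_eq_zero.mpr fun j hj =>
    (degree_lt_iff_coeff_zero _ _).mp hf j hj.le), fun f hf _ => h f hf⟩

theorem IsRepMeasure.matrix_conditions {x : ℝ} {μ : Measure ℝ} (hm : k₁ + k₂ = m + 1)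
    (h : IsRepMeasure (fill β k₂ x) k₁ k₂ μ) :
    IsPartiallyPSD (partialM β k₁ k₂) ∧
      (((M β (-k₁) (k₂ - 1)).PosDef ∧ (ATilde β k₁ k₂).PosDef) ∨
        ((M β (-k₁ + 1) (k₂ - 1)).rank = (M β (-k₁) (k₂ - 1)).rank ∧
          (M β (-k₁) (k₂ - 1)).rank = (M β (-k₁) (k₂ - 2)).rank ∧
          (M β (-k₁) (k₂ - 2)).rank = (AHat β k₁ k₂).rank)) := by
  refine ⟨isPartiallyPSD_of_nonneg hm fun f hf => h.mom_sq_nonneg (by omega), ?_⟩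
  by_cases hpd : (M β (-k₁) (k₂ - 1)).PosDef
  · refine Or.inl ⟨hpd, (posDef_ATilde_iff x hm).mpr fun f hf hf0 _ hne => ?_⟩
    refine lt_of_le_of_ne (h.mom_sq_nonneg (by omega)) fun hz => ?_
    have hae := h.ae_eval_eq_zero (by omega) hz.symm
    -- Without mass at 0, the isotropic X g can be replaced by g, which also vanishes almost
    -- everywhere but has degree at most m, against M(-k₁, k₂-1) ≻ 0.
    obtain ⟨g, rfl⟩ := X_dvd_iff.mpr hf0
    have hg0 : g ≠ 0 := by
      rintro rfl
      exact hne (mul_zero X)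
    rw [natDegree_X_mul hg0] at hf
    refine ((posDef_M_iff x hm).mp hpd g ?_ hg0).ne' ?_
    · rw [← natDegree_lt_iff_degree_lt hg0]
      omega
    · rw [← (h.integral_eq_mom (natDegree_mul_le.trans (by omega))).2]
      refine integral_eq_zero_of_ae ?_
      filter_upwards [hae, h.ae_ne_zero] with y hy hy0
      rw [eval_mul, eval_X] at hy
      rw [eval_mul, (mul_eq_zero.mp hy).resolve_left hy0]
      simp
  · refine Or.inr ?_
    rw [posDef_M_iff x hm] at hpd
    push Not at hpd
    obtain ⟨f, hf, hf0, hle⟩ := hpd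
    have hfd := (natDegree_lt_iff_degree_lt hf0).mpr hf
    -- An isotropic f of degree at most m leaves at most m atoms.
    obtain ⟨S, c, hS, hc, rfl⟩ := h.exists_eq_atomicMeasure (f := f) (by omega) hf0
      (le_antisymm hle (h.mom_sq_nonneg (by omega)))
    obtain ⟨h0, hat⟩ := AtomicMoments.of_isRepMeasure hc h
    rw [hm] at hat
    obtain ⟨r1, r2, r3, r4⟩ := rank_conditions_of_atomicMoments hm hat h0 (by omega)
    exact ⟨r1.trans r2.symm, r2.trans r3.symm, r3.trans r4.symm⟩

theorem IsPRG.posDef_conditions {x : ℝ} (hm : k₁ + k₂ = m + 1)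
    (h : IsPRG (shift (fill β k₂ x) k₁) (m + 1))
    (hs : ¬ IsSingularSeq (shift (fill β k₂ x) k₁) (m + 1)) :
    IsPartiallyPSD (partialM β k₁ k₂) ∧ (M β (-k₁) (k₂ - 1)).PosDef ∧
      (ATilde β k₁ k₂).PosDef := by
  have hrank : seqRank (shift (fill β k₂ x) k₁) (m + 1) = m + 2 := by
    rw [seqRank, if_pos fun hdet => hs (seqRank_lt_of_det_eq_zero hdet)]
  have hpd := (hankel_posDef_iff _ _).mp h.1
  rw [hrank] at hpd
  have hpos : ∀ f : ℝ[X], f.natDegree ≤ m + 1 → f ≠ 0 →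
      0 < mom (shift (fill β k₂ x) k₁) (f * f) := fun f hf hf0 =>
    hpd f ((natDegree_lt_iff_degree_lt hf0).mp (by omega)) hf0
  refine ⟨isPartiallyPSD_of_nonneg (x := x) hm fun f hf => ?_, (posDef_M_iff x hm).mpr fun f hf hf0 => ?_,
    (posDef_ATilde_iff x hm).mpr fun f hf _ _ hf0 => hpos f hf hf0⟩
  · by_cases hf0 : f = 0
    · simp [hf0]
    · exact (hpos f hf hf0).le
  · have := (natDegree_lt_iff_degree_lt hf0).mpr hf
    exact hpos f (by omega) hf0

theorem Admissible.isRG {x : ℝ} (hm : k₁ + k₂ = m + 1) (h : Admissible β k₁ k₂ x) :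
    IsSingularSeq (shift (fill β k₂ x) k₁) (m + 1) ∧
      IsRG (shift (fill β k₂ x) k₁) (m + 1) := by
  obtain ⟨S, ρ, h0, hS, hat⟩ := (admissible_iff_exists hm).mp h
  exact ⟨hat.isSingularSeq hS, hat.isPRG hS, hat.isNRG hS h0⟩

theorem IsRG.admissible {x : ℝ} (hm : k₁ + k₂ = m + 1)
    (h : IsRG (shift (fill β k₂ x) k₁) (m + 1))
    (hs : IsSingularSeq (shift (fill β k₂ x) k₁) (m + 1)) : Admissible β k₁ k₂ x := by
  obtain ⟨S, ρ, hS, hat⟩ := h.1.exists_atomicMoments hs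
  exact (admissible_iff_exists hm).mpr ⟨S, ρ, h.2.zero_notMem hat hS, hS, hat⟩

theorem Admissible.exists_isRepMeasure_unique {x : ℝ} (h : Admissible β k₁ k₂ x)
    (hm : k₁ + k₂ = m + 1) :
    ∃ μ : Measure ℝ, IsRepMeasure (fill β k₂ x) k₁ k₂ μ ∧
      μ.support = {y : ℝ | (genPoly (shift (fill β k₂ x) k₁) (k₁ + k₂)).IsRoot y} ∧
      ∀ ν : Measure ℝ, IsRepMeasure (fill β k₂ x) k₁ k₂ ν → ν = μ := by
  obtain ⟨S, ρ, h0, hS, hat⟩ := (admissible_iff_exists hm).mp h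
  rw [← hm] at hS hat
  refine ⟨_, hat.isRepMeasure h0, ?_, fun ν hν => hν.eq_of_atomicMoments hat hS⟩
  rw [support_atomicMeasure fun y hy =>
    div_pos (hat.pos y hy) (zpow_neg_two_mul_pos (fun hc => h0 (hc ▸ hy)) k₁), hat.genPoly_eq hS]
  ext y
  rw [Set.mem_ofPred_eq, IsRoot, nodePoly_eval_eq_zero, Finset.mem_coe]

/-- An admissible value exists only if the leading block is positive definite or both Schur
complements vanish. -/
theorem Admissible.posDef_or_eq_zero {x : ℝ} (hm : k₁ + k₂ = m + 1) (h : Admissible β k₁ k₂ x) :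
    IsPartiallyPSD (partialM β k₁ k₂) ∧ 0 ≤ tVal β k₁ k₂ ∧
      (x - center β k₁ k₂) ^ 2 ≤ sVal β k₁ k₂ * tVal β k₁ k₂ ∧
      (((M β (-k₁) (k₂ - 1)).PosDef ∧ 0 < sVal β k₁ k₂) ∨
        (sVal β k₁ k₂ = 0 ∧ tVal β k₁ k₂ = 0)) := by
  obtain ⟨S, ρ, h0, hS, hat⟩ := (admissible_iff_exists hm).mp h
  have hnonneg : ∀ f : ℝ[X], f.natDegree ≤ m + 1 →
      0 ≤ mom (shift (fill β k₂ x) k₁) (f * f) := fun f hf => hat.sq_nonneg hf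
  have hpsd := isPartiallyPSD_of_nonneg hm hnonneg
  obtain ⟨P, Q, hPQ⟩ := exists_isSchurPair_fill x hm hpsd
  obtain ⟨-, ht, hle⟩ := hPQ.sq_le_mul hnonneg
  refine ⟨hpsd, ht, hle, ?_⟩
  -- Exactly m + 1 atoms make the leading block definite; at most m atoms make both Schur
  -- complements vanish.
  rcases hS.eq_or_lt with hS' | hS'
  · have hpd : (M β (-k₁) (k₂ - 1)).PosDef :=
      (posDef_M_iff x hm).mpr fun f hf hf0 => hat.sq_pos hS (by rwa [hS']) hf0
    exact Or.inl ⟨hpd, (exists_atomicMoments_of_sq_eq hm hpd hPQ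
      ((admissible_iff_of_posDef hm hpd hpsd).mp h).1).1⟩
  · exact Or.inr (hPQ.eq_zero_of_card_le hat (by omega))

end Missing

end STHMP

end

/-! ### The equivalences and the description of the admissible values -/

theorem corollary4p2 (k₁ k₂ : ℕ) (hk₁ : 1 ≤ k₁) (hk₂ : 1 ≤ k₂) (β : ℤ → ℝ)
    (hβ : 0 < β (-2 * k₁)) :
    List.TFAE [
      ∃ x₀ : ℝ, ∃ μ : MeasureTheory.Measure ℝ, STHMP.IsRepMeasure (STHMP.fill β k₂ x₀) k₁ k₂ μ,
      ∃ x₀ : ℝ, STHMP.IsRG (STHMP.shift (STHMP.fill β k₂ x₀) k₁) (k₁ + k₂),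
      ∃ x₀ : ℝ, STHMP.IsSingularSeq (STHMP.shift (STHMP.fill β k₂ x₀) k₁) (k₁ + k₂) ∧
        STHMP.IsRG (STHMP.shift (STHMP.fill β k₂ x₀) k₁) (k₁ + k₂),
      ∃ x₀ : ℝ, STHMP.Admissible β k₁ k₂ x₀,
      STHMP.IsPartiallyPSD (STHMP.partialM β k₁ k₂) ∧
        (((STHMP.M β (-k₁) (k₂ - 1)).PosDef ∧ (STHMP.ATilde β k₁ k₂).PosDef) ∨
          ((STHMP.M β (-k₁ + 1) (k₂ - 1)).rank = (STHMP.M β (-k₁) (k₂ - 1)).rank ∧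
            (STHMP.M β (-k₁) (k₂ - 1)).rank = (STHMP.M β (-k₁) (k₂ - 2)).rank ∧
            (STHMP.M β (-k₁) (k₂ - 2)).rank = (STHMP.AHat β k₁ k₂).rank))] ∧
    ((∃ x₀ : ℝ, STHMP.Admissible β k₁ k₂ x₀) →
      ((STHMP.sVal β k₁ k₂ = 0 ∧ STHMP.tVal β k₁ k₂ = 0) →
        ∀ x₀ : ℝ, STHMP.Admissible β k₁ k₂ x₀ ↔ x₀ = STHMP.center β k₁ k₂) ∧
      (¬ (STHMP.sVal β k₁ k₂ = 0 ∧ STHMP.tVal β k₁ k₂ = 0) →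
        0 < STHMP.sVal β k₁ k₂ ∧ 0 ≤ STHMP.tVal β k₁ k₂ ∧
        ∀ x₀ : ℝ, STHMP.Admissible β k₁ k₂ x₀ ↔
          (x₀ = STHMP.center β k₁ k₂ + √(STHMP.sVal β k₁ k₂ * STHMP.tVal β k₁ k₂) ∨
            x₀ = STHMP.center β k₁ k₂ - √(STHMP.sVal β k₁ k₂ * STHMP.tVal β k₁ k₂)) ∧
          ¬ STHMP.IsExceptional β k₁ k₂ x₀) ∧
      (∀ x₀ : ℝ, STHMP.Admissible β k₁ k₂ x₀ →
        ∃ μ : MeasureTheory.Measure ℝ, STHMP.IsRepMeasure (STHMP.fill β k₂ x₀) k₁ k₂ μ ∧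
          μ.support =
            {x : ℝ | (STHMP.genPoly (STHMP.shift (STHMP.fill β k₂ x₀) k₁) (k₁ + k₂)).IsRoot x} ∧
          ∀ ν : MeasureTheory.Measure ℝ,
            STHMP.IsRepMeasure (STHMP.fill β k₂ x₀) k₁ k₂ ν → ν = μ)) := by
  obtain ⟨m, hm⟩ : ∃ m, k₁ + k₂ = m + 1 := ⟨k₁ + k₂ - 1, by omega⟩
  refine ⟨?_, ?_⟩
  · rw [hm]
    tfae_have 4 → 3 := fun ⟨x, hx⟩ => ⟨x, hx.isRG hm⟩
    tfae_have 3 → 2 := fun ⟨x, _, hx⟩ => ⟨x, hx⟩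
    tfae_have 4 → 1 := fun ⟨x, μ, hμ, _⟩ => ⟨x, μ, hμ⟩
    tfae_have 1 → 5 := fun ⟨x, μ, hμ⟩ => hμ.matrix_conditions hm
    tfae_have 2 → 5 := by
      rintro ⟨x, hx⟩
      -- A singular sequence has an atomic measure; a nonsingular one has positive definite full
      -- Hankel matrix, which gives alternative (a).
      by_cases hs : STHMP.IsSingularSeq (STHMP.shift (STHMP.fill β k₂ x) k₁) (m + 1)
      · obtain ⟨μ, hμ, -⟩ := hx.admissible hm hs
        exact hμ.matrix_conditions hm
      · obtain ⟨h1, h2⟩ := hx.1.posDef_conditions hm hs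
        exact ⟨h1, Or.inl h2⟩
    tfae_have 5 → 4 := by
      rintro ⟨h, ⟨h1, h2⟩ | ⟨h1, h2, h3⟩⟩
      · exact STHMP.exists_admissible_of_posDef hm h h1 h2
      · exact STHMP.exists_admissible_of_rank_eq hm h h1 h2 h3
    tfae_finish
  · rintro ⟨x₁, hx₁⟩
    refine ⟨?_, ?_, fun x hx => hx.exists_isRepMeasure_unique hm⟩
    · rintro ⟨hs, ht⟩
      have key : ∀ x, STHMP.Admissible β k₁ k₂ x → x = STHMP.center β k₁ k₂ := by
        intro x hx
        obtain ⟨-, -, hle, -⟩ := hx.posDef_or_eq_zero hm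
        rw [hs, zero_mul] at hle
        exact sub_eq_zero.mp (pow_eq_zero_iff two_ne_zero |>.mp (le_antisymm hle (sq_nonneg _)))
      -- That the center is admissible comes from the assumed admissible number, which must equal
      -- it.
      exact fun x => ⟨key x, fun hx => by rw [hx, ← key x₁ hx₁]; exact hx₁⟩
    · intro hst
      obtain ⟨hpsd, ht, -, h⟩ := hx₁.posDef_or_eq_zero hm
      obtain ⟨hpd, hs⟩ := h.resolve_right hst
      refine ⟨hs, ht, fun x => ?_⟩
      rw [STHMP.admissible_iff_of_posDef hm hpd hpsd]
      refine and_congr_left fun _ => ?_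
      rw [← Real.sq_sqrt (mul_nonneg hs.le ht), sq_eq_sq_iff_eq_or_eq_neg,
        Real.sqrt_sq (Real.sqrt_nonneg _), sub_eq_iff_eq_add', sub_eq_iff_eq_add', ← sub_eq_add_neg]
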